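/- **Setting.** For a real $3\times 3$ matrix $h=(h_{ij})$, the Gaussian interference channel $\mathrm{IC}(h)$ has outputs $Y_i(n)=\sum_{j=1}^3 h_{ij}X_j(n)+Z_i(n)$, $i=1,2,3$, with $Z_i(n)\sim\mathcal N(0,1)$ i.i.d. over users and symbols; receiver $i$ decodes the message $W_i$ of transmitter $i$. For a real $m\times 3$ matrix $H$ and a positive semidefinite $m\times m$ matrix $K$, the Gaussian multiple access channel $\mathrm{MAC}(H,K)$ has an $m$-antenna receiver that observes $H\,(X_1(n),X_2(n),X_3(n))^T+N(n)$, with $N(n)\sim\mathcal N(0,K)$ i.i.d. over symbols, and decodes all of $W_1,W_2,W_3$. The messages are independent and uniform, codes have block length $N$ and rates $\log|W_i|/N$ (natural logarithm), and satisfy the total power constraint $E\big[\tfrac1N\sum_{i=1}^{3}\sum_{n=1}^N X_i(n)^2\big]\le \mathrm{SNR}$. A rate vector $R$ is achievable if for every $\varepsilon>0$ and all sufficiently large $N$ there is a code with rates within $\varepsilon$ of $R$ and probability that some message is decoded wrongly at most $\varepsilon$. $C_{IC}(h)$ and $C_{MAC}(H,K)$ denote the resulting capacity regions at the same $\mathrm{SNR}\ge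 0$, and the sum capacity $C_\Sigma$ is the supremum of $R_1+R_2+R_3$ over the capacity region of the interference channel. **Enhanced receiver.** Let $i,j,k$ be the three users in any order and $a=(a_1,a_2,a_3)\in\mathbb R^3$. Receiver $i$ is enhanced to a two-antenna receiver that sees $Y_i'=\sum_l h_{il}X_l+Z_i'$ ($Y_i$ with a different noise power) and a genie signal $S=\sum_l a_lX_l+\tilde Z$, where $(Z_i',\tilde Z)$ is zero-mean Gaussian with covariance matrix $K$. Let $H_{i,a}$ be the $2\times3$ matrix with rows $(h_{i1},h_{i2},h_{i3})$ and $a$. For $\alpha,\beta\in\mathbb R$ let $u_l=\alpha h_{il}+\beta a_l$ be the coefficient of $X_l$ in $U=\alpha Y_i'+\beta S$. Call $(\alpha,\beta)$ *aligned* if $u_j\ne0$ and $u_k/u_j=h_{jk}/h_{jj}$. **Theorem.** Parts (1)–(4) hold for every $h$ with all entries non-zero, every such $i,j,k$ and every $a$. 1. (Outer bound.) If $(\alpha,\beta)$ is aligned, $K$ is positive semidefinite, and $$\mathrm{Var}(Z_i')\le 1,\qquad \mathrm{Var}(\alpha Z_i'+\beta\tilde Z)\le (u_j/h_{jj})^2,\qquad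 \mathrm{Var}(Z_i')\le (h_{ik}/h_{kk})^2,$$ then $C_{IC}(h)\subseteq C_{MAC}(H_{i,a},K)$ for every $\mathrm{SNR}\ge0$. In particular the bound may be optimized over all admissible $a$ and noise statistics. 2. If $h_{ij}a_k\neq h_{ik}a_j$, then an aligned pair $(\alpha,\beta)$ exists. 3. (Sufficient noise reduction.) If $(\alpha,\beta)$ is aligned and $s\ge0$ satisfies $\beta^2 s<(u_j/h_{jj})^2$, then there is $t>0$ such that, for every $\mathrm{SNR}\ge 0$, $C_{IC}(h)\subseteq C_{MAC}(H_{i,a},K)$ whenever $\mathrm{Var}(Z_i')\le t$ and $\mathrm{Var}(\tilde Z)\le s$, whatever the correlation of $Z_i'$ and $\tilde Z$. 4. (No genie.) If $h_{ik}/h_{ij}=h_{jk}/h_{jj}$ and $0\le t\le\min\{1,(h_{ij}/h_{jj})^2,(h_{ik}/h_{kk})^2\}$, then for every $\mathrm{SNR}\ge 0$ the region $C_{IC}(h)$ is contained in the capacity region of the single-antenna MAC with gains $(h_{i1},h_{i2},h_{i3})$ and noise variance $t$. 5. (Example 1.) Let $h_{ij}=1$ for $i\ne j$, and either $h_{11}=h_{22}=1$,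 $h_{33}=-1$, or $h_{11}=h_{22}=-1$, $h_{33}=1$. Then for every $\mathrm{SNR}\ge 0$ the region $C_{IC}(h)$ is contained in the capacity region of the single-antenna MAC with gains $(h_{11},h_{12},h_{13})$ and unit noise variance, and $C_\Sigma\le\frac12\log(1+\mathrm{SNR})$. 6. (Example 2.) Let $h_{ii}=1$ and $h_{ij}=c>1$ for $i\ne j$, and put $$H(a_1)=\begin{pmatrix}1&c&c\\ a_1&1-c&0\end{pmatrix}.$$ For every $\mathrm{SNR}\ge 0$, every $a_1\in\mathbb R$ and every covariance matrix $K$ of a Gaussian pair $(Z_1,\tilde Z_1)$ with $E[Z_1^2]=1$ and $E[(Z_1+\tilde Z_1)^2]\le1$, we have $C_{IC}(h)\subseteq C_{MAC}(H(a_1),K)$. Moreover $$C_\Sigma\le\frac12\min_{a_1,K}\ \log\frac{\big|K+\frac{\mathrm{SNR}}3H(a_1)H(a_1)^T\big|}{|K|},$$ where the minimum, which is attained, is over all $a_1\in\mathbb R$ and all such nonsingular $K$. -/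

import Mathlib

open MeasureTheory ProbabilityTheory
open scoped Matrix

noncomputable section

namespace GaussianNetwork

/-- Message set sizes of the three users: user `i` has the messages `0, …, M i - 1`. -/
abbrev Sizes := Fin 3 → ℕ

/-- The message triples `(W₁, W₂, W₃)`. -/
abbrev Messages (M : Sizes) := (i : Fin 3) → Fin (M i)

/-- Codebooks of block length `N`: user `i` sends the codeword `enc i w` for the message `w`. -/
abbrev Encoders (N : ℕ) (M : Sizes) := (i : Fin 3) → Fin (M i) → Fin N → ℝ

/-- The total transmit power `E[(1/N) ∑ᵢ ∑ₙ |Xᵢ(n)|²]`, with the messages independent and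
uniformly distributed. -/
def totalPower {N : ℕ} {M : Sizes} (enc : Encoders N M) : ℝ :=
  (∑ w : Messages M, (1 / (N : ℝ)) * ∑ i, ∑ n, (enc i (w i) n) ^ 2) /
    (Fintype.card (Messages M) : ℝ)

/-! ### The three-user interference channel -/

/-- The channel output `Yᵢ(n) = ∑ⱼ h i j * Xⱼ(n) + Zᵢ(n)` at the receiver `i`. -/
def icOutput (h : Matrix (Fin 3) (Fin 3) ℝ) {N : ℕ} {M : Sizes} (enc : Encoders N M)
    (w : Messages M) (z : Fin 3 → Fin N → ℝ) (i : Fin 3) : Fin N → ℝ :=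
  fun n => ∑ j, h i j * enc j (w j) n + z i n

/-- Noise of the interference channel: standard normal, i.i.d. across receivers and symbols. -/
def icNoise (N : ℕ) : Measure (Fin 3 → Fin N → ℝ) :=
  Measure.pi fun _ => Measure.pi fun _ => gaussianReal 0 1

/-- Probability that some receiver `i` decodes its message `Wᵢ` wrongly (uniform messages). -/
def icErrorProb (h : Matrix (Fin 3) (Fin 3) ℝ) {N : ℕ} {M : Sizes} (enc : Encoders N M)
    (dec : (i : Fin 3) → (Fin N → ℝ) → Fin (M i)) : ℝ :=
  (∑ w : Messages M, (icNoise N).real {z | ∃ i, dec i (icOutput h enc w z i) ≠ w i}) /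
    (Fintype.card (Messages M) : ℝ)

/-- The capacity region of the interference channel with gains `h` and unit noise power at each
receiver, under the total power constraint `P`: for every `ε > 0` and every large block length `N`
there is a code whose rates `log |Wᵢ| / N` are within `ε` of `R i`, which meets the power
constraint and whose error probability is at most `ε`. -/
def icCapacityRegion (h : Matrix (Fin 3) (Fin 3) ℝ) (P : ℝ) : Set (Fin 3 → ℝ) :=
  {R | ∀ ε > 0, ∃ N₀ : ℕ, ∀ N ≥ N₀, ∃ M : Sizes, (∀ i, 0 < M i) ∧
    (∀ i, |Real.log (M i) / N - R i| ≤ ε) ∧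
    ∃ (enc : Encoders N M) (dec : (i : Fin 3) → (Fin N → ℝ) → Fin (M i)),
      (∀ i, Measurable (dec i)) ∧ totalPower enc ≤ P ∧ icErrorProb h enc dec ≤ ε}

/-! ### The three-user multiple access channel with an `m`-antenna receiver -/

/-- The channel output: antenna `r` receives `∑ⱼ H r j * Xⱼ(n) + Z_r(n)` at symbol `n`. -/
def macOutput {m : ℕ} (H : Matrix (Fin m) (Fin 3) ℝ) {N : ℕ} {M : Sizes} (enc : Encoders N M)
    (w : Messages M) (z : Fin N → EuclideanSpace ℝ (Fin m)) : Fin N → Fin m → ℝ :=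
  fun n r => ∑ j, H r j * enc j (w j) n + z n r

/-- Noise of the multiple access channel: zero-mean Gaussian vectors with covariance `K`
across the antennas, i.i.d. across symbols. -/
def macNoise {m : ℕ} (K : Matrix (Fin m) (Fin m) ℝ) (N : ℕ) :
    Measure (Fin N → EuclideanSpace ℝ (Fin m)) :=
  Measure.pi fun _ => multivariateGaussian 0 K

/-- Probability that the receiver decodes the triple `(W₁, W₂, W₃)` wrongly (uniform messages). -/
def macErrorProb {m : ℕ} (H : Matrix (Fin m) (Fin 3) ℝ) (K : Matrix (Fin m) (Fin m) ℝ)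
    {N : ℕ} {M : Sizes} (enc : Encoders N M) (dec : (Fin N → Fin m → ℝ) → Messages M) : ℝ :=
  (∑ w : Messages M, (macNoise K N).real {z | dec (macOutput H enc w z) ≠ w}) /
    (Fintype.card (Messages M) : ℝ)

/-- The capacity region of the Gaussian multiple access channel with gains `H` and noise
covariance `K` (positive semidefinite), under the total power constraint `P`. -/
def macCapacityRegion {m : ℕ} (H : Matrix (Fin m) (Fin 3) ℝ) (K : Matrix (Fin m) (Fin m) ℝ)
    (P : ℝ) : Set (Fin 3 → ℝ) :=
  {R | ∀ ε > 0, ∃ N₀ : ℕ, ∀ N ≥ N₀, ∃ M : Sizes, (∀ i, 0 < M i) ∧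
    (∀ i, |Real.log (M i) / N - R i| ≤ ε) ∧
    ∃ (enc : Encoders N M) (dec : (Fin N → Fin m → ℝ) → Messages M),
      Measurable dec ∧ totalPower enc ≤ P ∧ macErrorProb H K enc dec ≤ ε}

/-- The sum capacity: the supremum of the sum rate over a capacity region. -/
def sumCapacity (C : Set (Fin 3 → ℝ)) : EReal :=
  ⨆ R ∈ C, ((∑ i, R i : ℝ) : EReal)

/-! ### The enhanced receiver -/

/-- Gains of the enhanced receiver `i`: the first antenna sees (a noise-reduced) `Yᵢ`, the second
one the genie signal `S = ∑ⱼ a j * Xⱼ + Z̃`. -/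
def enhancedGains (h : Matrix (Fin 3) (Fin 3) ℝ) (a : Fin 3 → ℝ) (i : Fin 3) :
    Matrix (Fin 2) (Fin 3) ℝ :=
  Matrix.of ![h i, a]

/-- The coefficient of `X_l` in the combination `U = α * Yᵢ + β * S`. -/
def combGain (h : Matrix (Fin 3) (Fin 3) ℝ) (a : Fin 3 → ℝ) (α β : ℝ) (i l : Fin 3) : ℝ :=
  α * h i l + β * a l

/-- The variance of `α * Z + β * Z̃` when `(Z, Z̃)` has the covariance matrix `K`. -/
def combVar (K : Matrix (Fin 2) (Fin 2) ℝ) (α β : ℝ) : ℝ :=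
  ![α, β] ⬝ᵥ (K *ᵥ ![α, β])

/-- In `U = α * Yᵢ + β * S` the inputs `X_j` and `X_k` occur in the same proportion as in `Y_j`
(with non-vanishing coefficient of `X_j`). -/
def Aligned (h : Matrix (Fin 3) (Fin 3) ℝ) (a : Fin 3 → ℝ) (α β : ℝ) (i j k : Fin 3) : Prop :=
  combGain h a α β i j ≠ 0 ∧
    combGain h a α β i k / combGain h a α β i j = h j k / h j j

/-! ### The examples -/

/-- First carrier: all gains `1` except `h₃₃ = -1`. -/
def carrierOne : Matrix (Fin 3) (Fin 3) ℝ := !![1, 1, 1; 1, 1, 1; 1, 1, -1]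

/-- Second carrier: all gains `1` except `h₁₁ = h₂₂ = -1`. -/
def carrierTwo : Matrix (Fin 3) (Fin 3) ℝ := !![-1, 1, 1; 1, -1, 1; 1, 1, 1]

/-- The perfectly symmetric channel with direct gains `1` and cross gains `c`. -/
def symmetricGains (c : ℝ) : Matrix (Fin 3) (Fin 3) ℝ := !![1, c, c; c, 1, c; c, c, 1]

/-- The gain matrix of the two-antenna receiver for the symmetric channel. -/
def symmetricMacGains (c a₁ : ℝ) : Matrix (Fin 2) (Fin 3) ℝ := !![1, c, c; a₁, 1 - c, 0]

/-- `log (|K + (P/3) H Hᵀ| / |K|)`. -/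
def logDetMac (H : Matrix (Fin 2) (Fin 3) ℝ) (K : Matrix (Fin 2) (Fin 2) ℝ) (P : ℝ) : ℝ :=
  Real.log ((K + (P / 3) • (H * Hᵀ)).det / K.det)

/-- The values of `logDetMac` that the genie for the symmetric channel can produce: `a₁` is
arbitrary, `K` is a nonsingular covariance matrix of `(Z₁, Z̃₁)` with `E[Z₁²] = 1` and
`E[(Z₁ + Z̃₁)²] ≤ 1`. -/
def symmetricBounds (c P : ℝ) : Set ℝ :=
  {v | ∃ (a₁ : ℝ) (K : Matrix (Fin 2) (Fin 2) ℝ), K.PosDef ∧ K 0 0 = 1 ∧ combVar K 1 1 ≤ 1 ∧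
    v = logDetMac (symmetricMacGains c a₁) K P}

end GaussianNetwork

end

noncomputable section

namespace GaussianNetwork

/-! ### Laws of linear images of Gaussian noise -/

/-! The enhanced receiver decodes all three messages by imitating the receivers of the interference
channel in turn. Its first antenna serves as receiver `i`. Once `W_i` is known, a rescaled aligned
combination `U` differs from a receiver-`j` output only through `X_i`, which is reconstructed. Once
`W_i` and `W_j` are known, any observation containing `X_k` can be scaled and corrected into a
receiver-`k` output. Each imitation has noise power at most one, and the deficit is filled with
independent Gaussian noise. Interference receivers do not cooperate, so only the marginal noise laws
matter, and a union bound costs a factor 3 in the error probability. `Emulates` records the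
algebraic conditions, and `Emulates.exists_decoder` turns them into a decoder for the same
codebooks. All region inclusions follow from it.

The sum-rate bounds add a weak converse, `one_sub_macErrorProb_mul_le`. Given the messages, the
whitened output is a product of unit-variance Gaussians. It is compared with one fixed product
Gaussian law by means of the Fano-type estimate `log_card_mul_sum_le`. Diagonalizing the noise and
`H Hᵀ` simultaneously makes this product law give the log-determinant formula.

In the symmetric channel only the total power is limited, so the individual powers may differ. Every
relabelling of the users yields another valid emulating receiver for the same code, and averaging
over the three cyclic ones replaces each power by a third of the total. The best genie is then found
by completing the square in the gain `a₁`, using affinity in the genie noise power, and completing a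
second square in the correlation. -/

theorem multivariateGaussian_map_dotProduct {m : ℕ} {K : Matrix (Fin m) (Fin m) ℝ}
    (hK : K.PosSemidef) (b : Fin m → ℝ) :
    (multivariateGaussian 0 K).map (fun z => ∑ r, b r * z r) =
      gaussianReal 0 (b ⬝ᵥ (K *ᵥ b)).toNNReal := by
  have hf : (fun z : EuclideanSpace ℝ (Fin m) => ∑ r, b r * z r) =
      innerSL ℝ (WithLp.toLp 2 b : EuclideanSpace ℝ (Fin m)) := by
    ext z
    simp [PiLp.inner_apply, mul_comm]
  rw [hf, IsGaussian.map_eq_gaussianReal, ContinuousLinearMap.integral_comp_id_comm]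
  · congr 2
    · simp
    rw [← covarianceBilin_multivariateGaussian (μ := 0) hK (WithLp.toLp 2 b) (WithLp.toLp 2 b),
      covarianceBilin_self IsGaussian.memLp_two_id]
    rfl
  · exact IsGaussian.integrable_id

/-- Characteristic functions decide: at `t` the exponent involves the quadratic form of `T * K *
Tᵀ`, which is `‖t‖ ^ 2`. The passage through `WithLp.toLp 2` supplies the inner product. -/
theorem multivariateGaussian_map_mulVec {m : ℕ} {K : Matrix (Fin m) (Fin m) ℝ}
    (hK : K.PosSemidef) {T : Matrix (Fin m) (Fin m) ℝ} (hT : T * K * Tᵀ = 1) :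
    (multivariateGaussian 0 K).map (fun z r => ∑ s, T r s * z s) =
      Measure.pi fun _ : Fin m => gaussianReal 0 1 := by
  have hm : Measurable fun (z : EuclideanSpace ℝ (Fin m)) r => ∑ s, T r s * z s := by fun_prop
  have key : ((multivariateGaussian 0 K).map (fun z r => ∑ s, T r s * z s)).map (WithLp.toLp 2) =
      (Measure.pi fun _ : Fin m => gaussianReal 0 1).map (WithLp.toLp 2) := by
    rw [map_pi_eq_stdGaussian, Measure.map_map (by fun_prop) hm]
    apply Measure.ext_of_charFun (E := EuclideanSpace ℝ (Fin m))
    ext t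
    have h1 : charFun ((multivariateGaussian 0 K).map
        ((WithLp.toLp 2 : (Fin m → ℝ) → EuclideanSpace ℝ (Fin m)) ∘
          fun z r => ∑ s, T r s * z s)) t =
        charFun (multivariateGaussian 0 K) (WithLp.toLp 2 (Tᵀ *ᵥ t.ofLp)) := by
      rw [charFun_apply, charFun_apply, integral_map (by fun_prop)
        (Measurable.aestronglyMeasurable (by fun_prop))]
      congr with z
      congr 3
      simp only [Function.comp, PiLp.inner_apply, Matrix.mulVec, dotProduct, Matrix.transpose_apply,
        RCLike.inner_apply, conj_trivial, Finset.mul_sum, Finset.sum_mul]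
      rw [Finset.sum_comm]
      exact Finset.sum_congr rfl fun _ _ => Finset.sum_congr rfl fun _ _ => by ring
    rw [h1, charFun_multivariateGaussian hK, charFun_stdGaussian]
    congr 1
    have h2 : (Tᵀ *ᵥ t.ofLp) ⬝ᵥ (K *ᵥ (Tᵀ *ᵥ t.ofLp)) = ‖t‖ ^ 2 := by
      rw [Matrix.mulVec_transpose, ← Matrix.dotProduct_mulVec, ← Matrix.mulVec_transpose,
        Matrix.mulVec_mulVec, Matrix.mulVec_mulVec, hT, Matrix.one_mulVec,
        EuclideanSpace.real_norm_sq_eq]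
      simp [dotProduct, sq]
    simp only [inner_zero_right, Complex.ofReal_zero, zero_mul, zero_sub]
    rw [h2]
    push_cast
    ring
  exact (MeasurableEquiv.toLp 2 (Fin m → ℝ)).map_measurableEquiv_injective key

instance isProbabilityMeasure_icNoise (N : ℕ) : IsProbabilityMeasure (icNoise N) := by
  unfold icNoise; infer_instance

instance isProbabilityMeasure_macNoise {m : ℕ} (K : Matrix (Fin m) (Fin m) ℝ) (N : ℕ) :
    IsProbabilityMeasure (macNoise K N) := by
  unfold macNoise; infer_instance

theorem multivariateGaussian_prod_map {m : ℕ} {K : Matrix (Fin m) (Fin m) ℝ}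
    (hK : K.PosSemidef) {b : Fin m → ℝ} {σ : ℝ} (hσ : b ⬝ᵥ (K *ᵥ b) + σ ^ 2 = 1) :
    ((multivariateGaussian 0 K).prod (gaussianReal 0 1)).map
      (fun p => ∑ r, b r * p.1 r + σ * p.2) = gaussianReal 0 1 := by
  have h : (fun p : EuclideanSpace ℝ (Fin m) × ℝ => ∑ r, b r * p.1 r + σ * p.2) =
      (fun q : ℝ × ℝ => q.1 + q.2) ∘
        Prod.map (fun z : EuclideanSpace ℝ (Fin m) => ∑ r, b r * z r) (fun x => σ * x) := rfl
  rw [h, ← Measure.map_map (by fun_prop) (by fun_prop),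
    ← Measure.map_prod_map _ _ (by fun_prop) (by fun_prop),
    multivariateGaussian_map_dotProduct hK, gaussianReal_map_const_mul]
  change Measure.conv _ _ = _
  rw [gaussianReal_conv_gaussianReal]
  congr 1
  · simp
  · have h0 : 0 ≤ b ⬝ᵥ (K *ᵥ b) := by simpa using hK.dotProduct_mulVec_nonneg b
    apply NNReal.eq
    simp [Real.coe_toNNReal _ h0, hσ]

/-- A combination of the antennas plus independent noise of the missing power is standard white
Gaussian noise. -/
theorem macNoise_prod_icNoise_map {m N : ℕ} {K : Matrix (Fin m) (Fin m) ℝ}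
    (hK : K.PosSemidef) {b : Fin m → ℝ} {σ : ℝ} (hσ : b ⬝ᵥ (K *ᵥ b) + σ ^ 2 = 1) (l : Fin 3) :
    ((icNoise N).prod (macNoise K N)).map (fun p n => ∑ r, b r * p.2 n r + σ * p.1 l n) =
      Measure.pi fun _ : Fin N => gaussianReal 0 1 := by
  have h1 : ((icNoise N).prod (macNoise K N)).map (fun p => (p.2, p.1 l)) =
      (macNoise K N).prod (Measure.pi fun _ : Fin N => gaussianReal 0 1) := by
    have : (fun p : (Fin 3 → Fin N → ℝ) × (Fin N → EuclideanSpace ℝ (Fin m)) => (p.2, p.1 l)) =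
        (Prod.map id (Function.eval l)) ∘ Prod.swap := rfl
    rw [this, ← Measure.map_map (by fun_prop) (by fun_prop), Measure.prod_swap,
      ← Measure.map_prod_map _ _ (by fun_prop) (by fun_prop), Measure.map_id]
    congr 1
    exact (measurePreserving_eval (fun _ : Fin 3 => Measure.pi fun _ : Fin N => gaussianReal 0 1)
      l).map_eq
  -- Regrouping the pair of sequences as a sequence of pairs reduces the claim to a single symbol.
  have h2 := (measurePreserving_arrowProdEquivProdArrow (EuclideanSpace ℝ (Fin m)) ℝ (Fin N)
    (fun _ => multivariateGaussian 0 K) (fun _ => gaussianReal 0 1)).map_eq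
  have h3 : (fun (p : (Fin 3 → Fin N → ℝ) × (Fin N → EuclideanSpace ℝ (Fin m))) (n : Fin N) =>
      ∑ r, b r * p.2 n r + σ * p.1 l n) =
      (fun (q : (Fin N → EuclideanSpace ℝ (Fin m)) × (Fin N → ℝ)) n =>
        ∑ r, b r * q.1 n r + σ * q.2 n) ∘ (fun p => (p.2, p.1 l)) := rfl
  rw [h3, ← Measure.map_map (by fun_prop) (by fun_prop), h1, macNoise, ← h2,
    Measure.map_map (by fun_prop) (by fun_prop)]
  have h4 : (fun (q : (Fin N → EuclideanSpace ℝ (Fin m)) × (Fin N → ℝ)) n =>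
        ∑ r, b r * q.1 n r + σ * q.2 n) ∘
        (MeasurableEquiv.arrowProdEquivProdArrow (EuclideanSpace ℝ (Fin m)) ℝ (Fin N)) =
      fun x n => (fun p : EuclideanSpace ℝ (Fin m) × ℝ => ∑ r, b r * p.1 r + σ * p.2) (x n) := rfl
  rw [h4, Measure.pi_map_pi (f := fun _ (p : EuclideanSpace ℝ (Fin m) × ℝ) =>
    ∑ r, b r * p.1 r + σ * p.2) (fun _ => by fun_prop)]
  simp_rw [multivariateGaussian_prod_map hK hσ]

/-- Used for the whitened output at a fixed message triple: with independent coordinates, likelihood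
ratios factor over symbols and antennas. -/
theorem macNoise_map_mulVec {m : ℕ} {K : Matrix (Fin m) (Fin m) ℝ}
    (hK : K.PosSemidef) {T : Matrix (Fin m) (Fin m) ℝ} (hT : T * K * Tᵀ = 1) {N : ℕ}
    (x : Fin N → Fin m → ℝ) :
    (macNoise K N).map (fun z n r => x n r + ∑ s, T r s * z n s) =
      Measure.pi fun n => Measure.pi fun r => gaussianReal (x n r) 1 := by
  have h (n : Fin N) : (multivariateGaussian 0 K).map (fun z r => x n r + ∑ s, T r s * z s) =
      Measure.pi fun r => gaussianReal (x n r) 1 := by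
    have : (fun (z : EuclideanSpace ℝ (Fin m)) r => x n r + ∑ s, T r s * z s) =
      (fun (g : Fin m → ℝ) r => x n r + g r) ∘ (fun z r => ∑ s, T r s * z s) := rfl
    rw [this, ← Measure.map_map (by fun_prop) (by fun_prop), multivariateGaussian_map_mulVec hK hT,
      Measure.pi_map_pi (f := fun r (y : ℝ) => x n r + y) (fun _ => by fun_prop)]
    simp_rw [gaussianReal_map_const_add, zero_add]
  rw [macNoise, Measure.pi_map_pi (f := fun n (z : EuclideanSpace ℝ (Fin m)) r =>
    x n r + ∑ s, T r s * z s) (fun _ => by fun_prop)]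
  simp_rw [h]

/-! ### Successive decoding at the multiple access receiver -/

/-- The receiver with gains `H` and noise covariance `K` can emulate, with unit noise power at most,
the output of the receivers `i`, then `j` once the message of user `i` is known, then `k` once those
of the users `i` and `j` are known. The combination used for user `l` is `b l`. -/
structure Emulates (h : Matrix (Fin 3) (Fin 3) ℝ) {m : ℕ} (H : Matrix (Fin m) (Fin 3) ℝ)
    (K : Matrix (Fin m) (Fin m) ℝ) (i j k : Fin 3) (b : Fin 3 → Fin m → ℝ) : Prop where
  posSemidef : K.PosSemidef
  ne_ij : i ≠ j
  ne_jk : j ≠ k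
  ne_ik : i ≠ k
  noise_le : ∀ l, b l ⬝ᵥ (K *ᵥ b l) ≤ 1
  first : ∀ l, (b i ᵥ* H) l = h i l
  second : ∀ l, l ≠ i → (b j ᵥ* H) l = h j l
  third : (b k ᵥ* H) k = h k k

/-- The estimate of message `l` is replaced by the decoder output of receiver `l` for the combined
output `y`, corrected by the interference reconstructed from the current estimate `w`. -/
def reestimate (g : Fin 3 → Fin 3 → ℝ) {N : ℕ} {M : Sizes} (enc : Encoders N M)
    (dec : (i : Fin 3) → (Fin N → ℝ) → Fin (M i)) (y : Fin 3 → Fin N → ℝ) (l : Fin 3)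
    (w : Messages M) : Messages M :=
  Function.update w l (dec l fun n => y l n + ∑ q, g l q * enc q (w q) n)

theorem measurable_reestimate (g : Fin 3 → Fin 3 → ℝ) {N : ℕ} {M : Sizes}
    (enc : Encoders N M) {dec : (i : Fin 3) → (Fin N → ℝ) → Fin (M i)}
    (hdec : ∀ i, Measurable (dec i)) {Ω : Type*} [MeasurableSpace Ω]
    {y : Ω → Fin 3 → Fin N → ℝ} (hy : Measurable y) (l : Fin 3) {w : Ω → Messages M}
    (hw : Measurable w) : Measurable fun ω => reestimate g enc dec (y ω) l (w ω) := by
  have hwi (i : Fin 3) : Measurable fun ω => w ω i := (measurable_pi_apply i).comp hw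
  refine measurable_pi_iff.2 fun i => ?_
  by_cases hi : i = l
  · subst hi
    simp only [reestimate, Function.update_self]
    refine (hdec i).comp (measurable_pi_iff.2 fun n => ?_)
    refine Measurable.add (by fun_prop) (Finset.measurable_sum _ fun q _ => ?_)
    exact measurable_const.mul ((measurable_of_finite fun v => enc q v n).comp (hwi q))
  · simpa only [reestimate, Function.update_of_ne hi] using hwi i

/-- A wrong entry of the current estimate does no harm where its correction coefficient vanishes, so
the decoder sees the same signal as with the true messages. -/
theorem reestimate_eq (g : Fin 3 → Fin 3 → ℝ) {N : ℕ} {M : Sizes}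
    (enc : Encoders N M) {dec : (i : Fin 3) → (Fin N → ℝ) → Fin (M i)}
    {y : Fin 3 → Fin N → ℝ} {l : Fin 3} {w₀ w : Messages M}
    (hg : ∀ q, g l q = 0 ∨ w₀ q = w q)
    (hl : dec l (fun n => y l n + ∑ q, g l q * enc q (w q) n) = w l) :
    reestimate g enc dec y l w₀ = Function.update w₀ l (w l) := by
  rw [reestimate]
  congr 1
  rw [← hl]
  congr 1
  ext n
  congr 1
  refine Finset.sum_congr rfl fun q _ => ?_
  rcases hg q with h | h
  · simp [h]
  · rw [h]

variable {h : Matrix (Fin 3) (Fin 3) ℝ} {m : ℕ} {H : Matrix (Fin m) (Fin 3) ℝ}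
  {K : Matrix (Fin m) (Fin m) ℝ} {i j k : Fin 3} {b : Fin 3 → Fin m → ℝ}

/-- The emulated receiver outputs: combined antennas, with additional noise `v`. -/
def emulated (b : Fin 3 → Fin m → ℝ) (K : Matrix (Fin m) (Fin m) ℝ) {N : ℕ}
    (v : Fin 3 → Fin N → ℝ) (y : Fin N → Fin m → ℝ) (l : Fin 3) (n : Fin N) : ℝ :=
  ∑ r, b l r * y n r + √(1 - b l ⬝ᵥ (K *ᵥ b l)) * v l n

/-- The decoder which estimates the messages of the users `i`, `j`, `k` in this order. -/
def successiveDecoder (h : Matrix (Fin 3) (Fin 3) ℝ) (H : Matrix (Fin m) (Fin 3) ℝ)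
    (K : Matrix (Fin m) (Fin m) ℝ) (b : Fin 3 → Fin m → ℝ) (i j k : Fin 3) {N : ℕ} {M : Sizes}
    (enc : Encoders N M) (dec : (i : Fin 3) → (Fin N → ℝ) → Fin (M i))
    (v : Fin 3 → Fin N → ℝ) (y : Fin N → Fin m → ℝ) : Messages M :=
  let g : Fin 3 → Fin 3 → ℝ := fun l q => h l q - (b l ᵥ* H) q
  let e := emulated b K v y
  -- The initial triple `dec l 0` is arbitrary: under `Emulates` the first stage needs no
  -- correction, and all three entries get overwritten.
  reestimate g enc dec e k (reestimate g enc dec e j (reestimate g enc dec e i fun l => dec l 0))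

theorem measurable_successiveDecoder {N : ℕ} {M : Sizes} (enc : Encoders N M)
    {dec : (i : Fin 3) → (Fin N → ℝ) → Fin (M i)} (hdec : ∀ i, Measurable (dec i))
    {Ω : Type*} [MeasurableSpace Ω] {v : Ω → Fin 3 → Fin N → ℝ} (hv : Measurable v)
    {y : Ω → Fin N → Fin m → ℝ} (hy : Measurable y) :
    Measurable fun ω => successiveDecoder h H K b i j k enc dec (v ω) (y ω) := by
  have he : Measurable fun ω => emulated b K (v ω) (y ω) := by
    unfold emulated
    fun_prop
  unfold successiveDecoder
  exact measurable_reestimate _ enc hdec he k (measurable_reestimate _ enc hdec he j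
    (measurable_reestimate _ enc hdec he i measurable_const))

/-- The noise at the emulated receiver `l`. -/
def emulatedNoise (b : Fin 3 → Fin m → ℝ) (K : Matrix (Fin m) (Fin m) ℝ) {N : ℕ}
    (p : (Fin 3 → Fin N → ℝ) × (Fin N → EuclideanSpace ℝ (Fin m))) (l : Fin 3) (n : Fin N) : ℝ :=
  ∑ r, b l r * p.2 n r + √(1 - b l ⬝ᵥ (K *ᵥ b l)) * p.1 l n

theorem emulated_macOutput {N : ℕ} {M : Sizes} (enc : Encoders N M) (w : Messages M)
    (v : Fin 3 → Fin N → ℝ) (z : Fin N → EuclideanSpace ℝ (Fin m)) (l : Fin 3) (n : Fin N) :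
    emulated b K v (macOutput H enc w z) l n + ∑ q, (h l q - (b l ᵥ* H) q) * enc q (w q) n =
      icOutput h enc w (emulatedNoise b K (v, z)) l n := by
  have : ∑ r, b l r * ∑ q, H r q * enc q (w q) n = ∑ q, (b l ᵥ* H) q * enc q (w q) n := by
    simp only [Finset.mul_sum, Matrix.vecMul, dotProduct, Finset.sum_mul]
    rw [Finset.sum_comm]
    exact Finset.sum_congr rfl fun _ _ => Finset.sum_congr rfl fun _ _ => by ring
  simp only [emulated, macOutput, icOutput, emulatedNoise, mul_add, Finset.sum_add_distrib, this,
    sub_mul, Finset.sum_sub_distrib]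
  ring

/-- The fields `first`, `second`, `third` say exactly that each stage needs corrections only from
users already decoded. -/
theorem Emulates.successiveDecoder_eq (hE : Emulates h H K i j k b) {N : ℕ} {M : Sizes}
    (enc : Encoders N M) {dec : (i : Fin 3) → (Fin N → ℝ) → Fin (M i)} (w : Messages M)
    (v : Fin 3 → Fin N → ℝ) (z : Fin N → EuclideanSpace ℝ (Fin m))
    (hw : ∀ l, dec l (icOutput h enc w (emulatedNoise b K (v, z)) l) = w l) :
    successiveDecoder h H K b i j k enc dec v (macOutput H enc w z) = w := by
  have hw' (l : Fin 3) : dec l (fun n => emulated b K v (macOutput H enc w z) l n +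
      ∑ q, (h l q - (b l ᵥ* H) q) * enc q (w q) n) = w l := by
    rw [← hw l]
    congr 1
    ext n
    exact emulated_macOutput enc w v z l n
  have hijk (l : Fin 3) : l = i ∨ l = j ∨ l = k := by
    have := hE.ne_ij; have := hE.ne_jk; have := hE.ne_ik
    omega
  have h1 := reestimate_eq (fun l q => h l q - (b l ᵥ* H) q) enc (w₀ := fun l => dec l 0)
    (fun q => Or.inl (by rw [hE.first, sub_self])) (hw' i)
  have h2 := reestimate_eq (fun l q => h l q - (b l ᵥ* H) q) enc
    (w₀ := Function.update (fun l => dec l 0) i (w i)) (fun q => by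
      by_cases hq : q = i
      · subst hq; simp
      · left; rw [hE.second q hq, sub_self]) (hw' j)
  have h3 := reestimate_eq (fun l q => h l q - (b l ᵥ* H) q) enc
    (w₀ := Function.update (Function.update (fun l => dec l 0) i (w i)) j (w j)) (fun q => by
      rcases hijk q with rfl | rfl | rfl
      · simp [Function.update_of_ne, hE.ne_ij]
      · simp
      · left; rw [hE.third, sub_self]) (hw' k)
  unfold successiveDecoder
  simp only [h1, h2, h3]
  ext l : 1
  rcases hijk l with rfl | rfl | rfl <;>
    simp [Function.update_of_ne, hE.ne_ij, hE.ne_jk, hE.ne_ik]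

theorem Emulates.map_emulatedNoise (hE : Emulates h H K i j k b) (N : ℕ) (l : Fin 3) :
    ((icNoise N).prod (macNoise K N)).map (fun p => emulatedNoise b K p l) =
      (icNoise N).map (fun z => z l) := by
  have h1 : (icNoise N).map (fun z => z l) = Measure.pi fun _ : Fin N => gaussianReal 0 1 :=
    (measurePreserving_eval (fun _ : Fin 3 => Measure.pi fun _ : Fin N => gaussianReal 0 1)
      l).map_eq
  rw [h1]
  refine macNoise_prod_icNoise_map hE.posSemidef ?_ l
  rw [Real.sq_sqrt (sub_nonneg.2 (hE.noise_le l))]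
  ring

/-- From a code for the interference channel, a decoder for the multiple access channel of an
emulating receiver with the same encoders. -/
theorem Emulates.exists_decoder (hE : Emulates h H K i j k b) {N : ℕ} {M : Sizes}
    (enc : Encoders N M) {dec : (i : Fin 3) → (Fin N → ℝ) → Fin (M i)}
    (hdec : ∀ i, Measurable (dec i)) :
    ∃ dec' : (Fin N → Fin m → ℝ) → Messages M, Measurable dec' ∧
      macErrorProb H K enc dec' ≤ 3 * icErrorProb h enc dec := by
  -- Only correctness and joint measurability of the decoder matter below, so it is kept opaque.
  obtain ⟨D, hDeq, hDm⟩ : ∃ D : (Fin 3 → Fin N → ℝ) → (Fin N → Fin m → ℝ) → Messages M,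
      (∀ (w : Messages M) (p : (Fin 3 → Fin N → ℝ) × (Fin N → EuclideanSpace ℝ (Fin m))),
        (∀ l, dec l (icOutput h enc w (emulatedNoise b K p) l) = w l) →
          D p.1 (macOutput H enc w p.2) = w) ∧
      ∀ {Ω : Type} [MeasurableSpace Ω] {v : Ω → Fin 3 → Fin N → ℝ}
        {y : Ω → Fin N → Fin m → ℝ}, Measurable v → Measurable y →
        Measurable fun ω => D (v ω) (y ω) :=
    ⟨successiveDecoder h H K b i j k enc dec, fun w p => hE.successiveDecoder_eq enc w p.1 p.2,
      fun hv hy => measurable_successiveDecoder enc hdec hv hy⟩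
  have hout (w : Messages M) : Measurable fun z => macOutput H enc w z := by
    unfold macOutput; fun_prop
  have hic (w : Messages M) (l : Fin 3) : Measurable fun (z : Fin N → ℝ) n =>
      ∑ q, h l q * enc q (w q) n + z n := by fun_prop
  have hbad (w : Messages M) : MeasurableSet {p : (Fin 3 → Fin N → ℝ) ×
      (Fin N → EuclideanSpace ℝ (Fin m)) | D p.1 (macOutput H enc w p.2) ≠ w} := by
    have : Measurable fun p : (Fin 3 → Fin N → ℝ) × (Fin N → EuclideanSpace ℝ (Fin m)) =>
        D p.1 (macOutput H enc w p.2) :=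
      hDm measurable_fst ((hout w).comp measurable_snd)
    exact this (MeasurableSet.singleton w).compl
  have hper (w : Messages M) : ((icNoise N).prod (macNoise K N)).real
      {p | D p.1 (macOutput H enc w p.2) ≠ w} ≤
      3 * (icNoise N).real {z | ∃ i, dec i (icOutput h enc w z i) ≠ w i} := by
    have hsub : {p : (Fin 3 → Fin N → ℝ) × (Fin N → EuclideanSpace ℝ (Fin m)) |
        D p.1 (macOutput H enc w p.2) ≠ w} ⊆
        ⋃ l, {p | dec l (icOutput h enc w (emulatedNoise b K p) l) ≠ w l} := by
      intro p hp
      by_contra hcon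
      simp only [Set.mem_iUnion, Set.mem_ofPred_eq, not_exists, not_not] at hcon
      exact hp (hDeq w p hcon)
    -- The emulated noises of different receivers may be correlated, unlike those of the
    -- interference channel. The union bound needs only their marginal laws.
    refine (measureReal_mono hsub).trans ((measureReal_iUnion_fintype_le _).trans ?_)
    have hle (l : Fin 3) : ((icNoise N).prod (macNoise K N)).real
        {p | dec l (icOutput h enc w (emulatedNoise b K p) l) ≠ w l} ≤
        (icNoise N).real {z | ∃ i, dec i (icOutput h enc w z i) ≠ w i} := by
      set S : Set (Fin N → ℝ) :=
        {g | dec l (fun n => ∑ q, h l q * enc q (w q) n + g n) ≠ w l} with hS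
      have hSm : MeasurableSet S :=
        ((hdec l).comp (hic w l)) (MeasurableSet.singleton (w l)).compl
      have e1 : ((icNoise N).prod (macNoise K N)).real
          {p | dec l (icOutput h enc w (emulatedNoise b K p) l) ≠ w l} =
          (((icNoise N).prod (macNoise K N)).map (fun p => emulatedNoise b K p l)).real S := by
        rw [map_measureReal_apply (by unfold emulatedNoise; fun_prop) hSm]
        rfl
      have e2 : ((icNoise N).map (fun z => z l)).real S =
          (icNoise N).real {z | dec l (icOutput h enc w z l) ≠ w l} := by
        rw [map_measureReal_apply (by fun_prop) hSm]
        rfl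
      rw [e1, hE.map_emulatedNoise, e2]
      exact measureReal_mono fun z hz => ⟨l, hz⟩
    calc _ ≤ ∑ _l : Fin 3, (icNoise N).real {z | ∃ i, dec i (icOutput h enc w z i) ≠ w i} :=
          Finset.sum_le_sum fun l _ => hle l
      _ = _ := by simp
  have hprod (w : Messages M) : Integrable (fun v => (macNoise K N).real
      {z | D v (macOutput H enc w z) ≠ w}) (icNoise N) ∧
      ∫ v, (macNoise K N).real {z | D v (macOutput H enc w z) ≠ w} ∂icNoise N =
      ((icNoise N).prod (macNoise K N)).real {p | D p.1 (macOutput H enc w p.2) ≠ w} := by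
    have hm := measurable_measure_prodMk_left (ν := macNoise K N) (hbad w)
    constructor
    · refine Integrable.of_bound (C := 1) hm.ennreal_toReal.aestronglyMeasurable
        (Filter.Eventually.of_forall fun v => ?_)
      rw [Real.norm_of_nonneg measureReal_nonneg]
      exact measureReal_le_one
    · rw [Measure.real, Measure.prod_apply (hbad w)]
      exact integral_toReal hm.aemeasurable (Filter.Eventually.of_forall fun v => measure_lt_top _ _)
  have hint : Integrable (fun v => macErrorProb H K enc (D v)) (icNoise N) :=
    (integrable_finsetSum _ fun w _ => (hprod w).1).div_const _
  -- The added noise acts as decoder randomness; some realization does no worse than the average,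
  -- and fixing it gives a deterministic decoder.
  obtain ⟨v, hv⟩ := exists_le_integral hint
  refine ⟨D v, hDm measurable_const measurable_id, hv.trans ?_⟩
  have : ∫ v, macErrorProb H K enc (D v) ∂icNoise N =
      (∑ w : Messages M, ((icNoise N).prod (macNoise K N)).real
        {p | D p.1 (macOutput H enc w p.2) ≠ w}) / (Fintype.card (Messages M) : ℝ) := by
    simp only [macErrorProb]
    rw [integral_div, integral_finsetSum _ fun w _ => (hprod w).1]
    simp_rw [fun w => (hprod w).2]
  rw [this, icErrorProb, ← mul_div_assoc, Finset.mul_sum]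
  gcongr with w
  exact hper w

/-- The capacity region of the interference channel is contained in that of an emulating multiple
access receiver. -/
theorem Emulates.icCapacityRegion_subset (hE : Emulates h H K i j k b) (P : ℝ) :
    icCapacityRegion h P ⊆ macCapacityRegion H K P := by
  intro R hR ε hε
  obtain ⟨N₀, hN₀⟩ := hR (ε / 3) (by positivity)
  refine ⟨N₀, fun N hN => ?_⟩
  obtain ⟨M, hM, hrate, enc, dec, hdec, hpow, herr⟩ := hN₀ N hN
  obtain ⟨dec', hdec', herr'⟩ := hE.exists_decoder enc hdec
  exact ⟨M, hM, fun i => (hrate i).trans (by linarith), enc, dec', hdec', hpow, by linarith⟩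

/-! ### Log-likelihood ratios -/

/-- `L` is the log-likelihood ratio `log dP/dQ`, and its mean under `P` (the relative entropy of `P`
and `Q`) is `D`. -/
structure HasLogRatio {α : Type*} [MeasurableSpace α] (P Q : Measure α) (L : α → ℝ) (D : ℝ) :
    Prop where
  measurable : Measurable L
  integrable : Integrable L P
  integral_eq : ∫ x, L x ∂P = D
  withDensity_eq : P.withDensity (fun x => ENNReal.ofReal (Real.exp (-L x))) = Q

theorem HasLogRatio.integrable_exp {α : Type*} [MeasurableSpace α] {P Q : Measure α}
    [IsFiniteMeasure Q] {L : α → ℝ} {D : ℝ} (h : HasLogRatio P Q L D) :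
    Integrable (fun x => Real.exp (-L x)) P := by
  have hm := h.measurable
  refine ⟨by fun_prop, ?_⟩
  rw [hasFiniteIntegral_iff_ofReal (Filter.Eventually.of_forall fun x => (Real.exp_pos _).le)]
  have : ∫⁻ x, ENNReal.ofReal (Real.exp (-L x)) ∂P = Q Set.univ := by
    rw [← h.withDensity_eq, withDensity_apply _ MeasurableSet.univ, Measure.restrict_univ]
  rw [this]
  exact measure_lt_top _ _

theorem HasLogRatio.setIntegral_exp {α : Type*} [MeasurableSpace α] {P Q : Measure α}
    [IsFiniteMeasure Q] {L : α → ℝ} {D : ℝ} (h : HasLogRatio P Q L D) {A : Set α}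
    (hA : MeasurableSet A) : ∫ x in A, Real.exp (-L x) ∂P = Q.real A := by
  rw [integral_eq_lintegral_of_nonneg_ae (Filter.Eventually.of_forall fun x => (Real.exp_pos _).le)
    h.integrable_exp.aestronglyMeasurable.restrict, Measure.real, ← h.withDensity_eq,
    withDensity_apply _ hA]

/-- Additivity of relative entropy over independent coordinates. The density identity is checked on
boxes, where the integral of a product factors. -/
theorem HasLogRatio.pi {ι : Type*} [Fintype ι] {α : ι → Type*} [∀ i, MeasurableSpace (α i)]
    {P Q : (i : ι) → Measure (α i)} [∀ i, IsProbabilityMeasure (P i)]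
    [∀ i, IsProbabilityMeasure (Q i)] {L : (i : ι) → α i → ℝ} {D : ι → ℝ}
    (h : ∀ i, HasLogRatio (P i) (Q i) (L i) (D i)) :
    HasLogRatio (Measure.pi P) (Measure.pi Q) (fun x => ∑ i, L i (x i)) (∑ i, D i) := by
  have hm i := (h i).measurable
  refine ⟨by fun_prop, integrable_finsetSum _ fun i _ => integrable_comp_eval (h i).integrable, ?_,
    ?_⟩
  · rw [integral_finsetSum _ fun i _ => integrable_comp_eval (h i).integrable]
    refine Finset.sum_congr rfl fun i _ => ?_
    rw [← (h i).integral_eq]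
    exact integral_comp_eval (h i).integrable.aestronglyMeasurable
  · refine (Measure.pi_eq fun s hs => ?_).symm
    rw [withDensity_apply _ (MeasurableSet.univ_pi hs), Measure.restrict_pi_pi]
    have hint i : Integrable (fun x => Real.exp (-L i x)) ((P i).restrict (s i)) :=
      (h i).integrable_exp.restrict
    have h1 (x : (i : ι) → α i) : Real.exp (-∑ i, L i (x i)) = ∏ i, Real.exp (-L i (x i)) := by
      rw [← Finset.sum_neg_distrib, Real.exp_sum]
    simp_rw [h1]
    rw [← ofReal_integral_eq_lintegral_ofReal (Integrable.fintype_prod_dep hint)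
      (Filter.Eventually.of_forall fun x => Finset.prod_nonneg fun i _ => (Real.exp_pos _).le),
      integral_fintype_prod_eq_prod (fun i x => Real.exp (-L i x)),
      ENNReal.ofReal_prod_of_nonneg fun i _ => integral_nonneg fun x => (Real.exp_pos _).le]
    refine Finset.prod_congr rfl fun i _ => ?_
    rw [(h i).setIntegral_exp (hs i), ofReal_measureReal]

theorem integrable_sq_gaussianReal (x : ℝ) (v : NNReal) :
    Integrable (fun y => y ^ 2) (gaussianReal x v) := by
  simpa using (memLp_id_gaussianReal (μ := x) (v := v) 2).integrable_sq

theorem integral_sq_gaussianReal (x : ℝ) (v : NNReal) :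
    ∫ y, y ^ 2 ∂gaussianReal x v = x ^ 2 + v := by
  have h := variance_eq_sub (memLp_id_gaussianReal (μ := x) (v := v) 2)
  rw [variance_id_gaussianReal] at h
  simp only [Pi.pow_apply, id_eq, integral_id_gaussianReal] at h
  linarith

theorem hasLogRatio_gaussianReal (x μ : ℝ) {lam : ℝ} (hlam : 0 < lam) :
    HasLogRatio (gaussianReal x 1) (gaussianReal μ lam.toNNReal)
      (fun y => 1 / 2 * Real.log lam - (y - x) ^ 2 / 2 + (y - μ) ^ 2 / (2 * lam))
      (1 / 2 * (Real.log lam - 1 + (1 + (x - μ) ^ 2) / lam)) := by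
  have hid : Integrable (fun y : ℝ => y) (gaussianReal x 1) :=
    (memLp_id_gaussianReal (μ := x) (v := 1) 1).integrable le_rfl
  have hsq := integrable_sq_gaussianReal x 1
  -- As a quadratic polynomial in `y`, the log ratio needs only the first two moments.
  have hexp : (fun y : ℝ => 1 / 2 * Real.log lam - (y - x) ^ 2 / 2 + (y - μ) ^ 2 / (2 * lam)) =
      fun y => (1 / 2 * Real.log lam - x ^ 2 / 2 + μ ^ 2 / (2 * lam)) + (x - μ / lam) * y +
        (1 / (2 * lam) - 1 / 2) * y ^ 2 := by
    ext y; field_simp; ring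
  have hlin : Integrable (fun y : ℝ => (1 / 2 * Real.log lam - x ^ 2 / 2 + μ ^ 2 / (2 * lam)) +
      (x - μ / lam) * y) (gaussianReal x 1) := (integrable_const _).add (hid.const_mul _)
  refine ⟨by fun_prop, ?_, ?_, ?_⟩
  · rw [hexp]
    exact hlin.add (hsq.const_mul _)
  · rw [hexp, integral_add hlin (hsq.const_mul _),
      integral_add (integrable_const _) (hid.const_mul _), integral_const_mul, integral_const_mul,
      integral_const, integral_sq_gaussianReal, integral_id_gaussianReal]
    simp
    field_simp
    ring
  · have hne : lam.toNNReal ≠ 0 := by simpa using hlam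
    rw [gaussianReal_of_var_ne_zero _ one_ne_zero, gaussianReal_of_var_ne_zero _ hne,
      ← withDensity_mul _ (measurable_gaussianPDF _ _) (by fun_prop)]
    congr 1
    ext y
    simp only [Pi.mul_apply, gaussianPDF]
    rw [← ENNReal.ofReal_mul (gaussianPDFReal_nonneg _ _ _)]
    congr 1
    simp only [gaussianPDFReal, NNReal.coe_one, mul_one, Real.coe_toNNReal _ hlam.le]
    have hs : Real.exp (-(1 / 2 * Real.log lam)) = (√lam)⁻¹ := by
      rw [Real.exp_neg, one_div, mul_comm, ← div_eq_mul_inv, Real.exp_half, Real.exp_log hlam]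
    rw [Real.sqrt_mul (x := 2 * Real.pi) (by positivity) lam, mul_inv, ← hs, mul_assoc, mul_assoc, ← Real.exp_add,
      ← Real.exp_add]
    congr 2
    field_simp
    ring

/-! ### Weak converse -/

/-- Fano-type bound: disjoint decision regions for the laws `P w` are limited by the mean relative
entropy to any common law `Q`. -/
theorem log_card_mul_sum_le {W α : Type*} [Fintype W] [Nonempty W] [MeasurableSpace α]
    {P : W → Measure α} [∀ w, IsProbabilityMeasure (P w)] {Q : Measure α} [IsProbabilityMeasure Q]
    {L : W → α → ℝ} {D : W → ℝ} (h : ∀ w, HasLogRatio (P w) Q (L w) (D w)) {A : W → Set α}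
    (hA : ∀ w, MeasurableSet (A w)) (hd : Pairwise (Function.onFun Disjoint A)) :
    Real.log (Fintype.card W) * ∑ w, (P w).real (A w) ≤
      ∑ w, D w + Fintype.card W * Real.log 2 := by
  classical
  set M : ℝ := (Fintype.card W : ℝ) with hM
  have hM1 : 1 ≤ M := by
    rw [hM]; exact_mod_cast Fintype.card_pos
  have key (w : W) : Real.log M * (P w).real (A w) - D w - Real.log 2 + 1 ≤
      (1 + (M - 1) * Q.real (A w)) / 2 := by
    have hi1 : Integrable ((A w).indicator fun _ => Real.log M) (P w) :=
      (integrable_const _).indicator (hA w)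
    have hi2 : Integrable ((A w).indicator fun x => (M - 1) * Real.exp (-L w x)) (P w) :=
      ((h w).integrable_exp.const_mul _).indicator (hA w)
    have hi3 : Integrable (fun x => (A w).indicator (fun _ => Real.log M) x - L w x) (P w) :=
      hi1.sub (h w).integrable
    -- This is `1 + t ≤ exp t` with `t = 1_A log M - L - log 2`, a Donsker–Varadhan bound. Since the
    -- integrals of `exp (1_A log M - L)` sum over `w` to at most `2 * M - 1`, the shift by `log 2`
    -- is what absorbs them.
    have hpt (x : α) : (A w).indicator (fun _ => Real.log M) x - L w x + (1 - Real.log 2) ≤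
        (Real.exp (-L w x) + (A w).indicator (fun x => (M - 1) * Real.exp (-L w x)) x) / 2 := by
      have hx := Real.add_one_le_exp
        ((A w).indicator (fun _ => Real.log M) x - L w x - Real.log 2)
      rw [Real.exp_sub, Real.exp_log two_pos, sub_eq_add_neg _ (L w x), Real.exp_add] at hx
      by_cases hxA : x ∈ A w
      · simp only [Set.indicator_of_mem hxA] at hx ⊢
        rw [Real.exp_log (by linarith)] at hx
        linarith
      · simp only [Set.indicator_of_notMem hxA, Real.exp_zero] at hx ⊢
        linarith
    have := integral_mono (hi3.add (integrable_const (1 - Real.log 2)))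
      (((h w).integrable_exp.add hi2).div_const 2) hpt
    have e1 : ∫ x, ((A w).indicator (fun _ => Real.log M) x - L w x + (1 - Real.log 2)) ∂P w =
        Real.log M * (P w).real (A w) - D w + (1 - Real.log 2) := by
      rw [integral_add hi3 (integrable_const _),
        integral_sub hi1 (h w).integrable, (h w).integral_eq, integral_indicator (hA w)]
      simp [mul_comm]
    have e2 : ∫ x, (Real.exp (-L w x) +
        (A w).indicator (fun x => (M - 1) * Real.exp (-L w x)) x) / 2 ∂P w =
        (1 + (M - 1) * Q.real (A w)) / 2 := by
      rw [integral_div, integral_add (h w).integrable_exp hi2, integral_indicator (hA w),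
        integral_const_mul, (h w).setIntegral_exp (hA w), ← setIntegral_univ,
        (h w).setIntegral_exp MeasurableSet.univ]
      simp
    simp only [Pi.add_apply] at this
    linarith
  have hQ : ∑ w, Q.real (A w) ≤ 1 := by
    rw [← measureReal_iUnion_fintype hd hA]
    exact measureReal_le_one
  have hsum := Finset.sum_le_sum fun w (_ : w ∈ Finset.univ) => key w
  simp only [Finset.sum_add_distrib, Finset.sum_sub_distrib, ← Finset.mul_sum, ← Finset.sum_div,
    Finset.sum_const, Finset.card_univ, nsmul_eq_mul, mul_one, ← hM] at hsum
  nlinarith [mul_le_mul_of_nonneg_left hQ (sub_nonneg.2 hM1)]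

/-! ### Second moments of independent codewords -/

/-- A sum over triples of a product of one-user factors is a product of sums; here every factor
except that of `q` is 1. -/
theorem sum_messages_apply {M : Sizes} (hM : ∀ i, 0 < M i) (ψ : (i : Fin 3) → Fin (M i) → ℝ)
    (q : Fin 3) : ∑ w : Messages M, ψ q (w q) =
      Fintype.card (Messages M) * ((∑ v, ψ q v) / M q) := by
  have h := Fintype.prod_sum fun i v => if i = q then ψ i v else 1
  have h1 (w : Messages M) : ∏ i, (if i = q then ψ i (w i) else 1) = ψ q (w q) := by simp
  simp_rw [h1] at h
  have h2 (i : Fin 3) : ∑ v, (if i = q then ψ i v else 1) =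
      M i * (if i = q then (∑ v, ψ i v) / M i else 1) := by
    have : (M i : ℝ) ≠ 0 := by exact_mod_cast (hM i).ne'
    split_ifs
    · field_simp
    · simp
  simp_rw [h2, Finset.prod_mul_distrib] at h
  rw [← h]
  simp

theorem sum_messages_mul {M : Sizes} {φ : (i : Fin 3) → Fin (M i) → ℝ} {q p : Fin 3} (hqp : q ≠ p)
    (hφ : ∑ v, φ q v = 0) : ∑ w : Messages M, φ q (w q) * φ p (w p) = 0 := by
  have h := Fintype.prod_sum fun i v => (if i = q then φ i v else 1) * (if i = p then φ i v else 1)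
  have h1 (w : Messages M) : ∏ i, ((if i = q then φ i (w i) else 1) *
      (if i = p then φ i (w i) else 1)) = φ q (w q) * φ p (w p) := by
    rw [Finset.prod_mul_distrib]
    simp
  simp_rw [h1] at h
  rw [← h]
  exact Finset.prod_eq_zero (Finset.mem_univ q) (by simp [hqp, hφ])

/-- Variances of independent users add: the cross terms vanish because each `φ q` is centred. -/
theorem sum_messages_sq {M : Sizes} (hM : ∀ i, 0 < M i) {φ : (i : Fin 3) → Fin (M i) → ℝ}
    (hφ : ∀ q, ∑ v, φ q v = 0) (c : Fin 3 → ℝ) :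
    ∑ w : Messages M, (∑ q, c q * φ q (w q)) ^ 2 =
      Fintype.card (Messages M) * ∑ q, c q ^ 2 * ((∑ v, φ q v ^ 2) / M q) := by
  have h1 (w : Messages M) : (∑ q, c q * φ q (w q)) ^ 2 =
      ∑ q, ∑ p, c q * c p * (φ q (w q) * φ p (w p)) := by
    rw [sq, Finset.sum_mul_sum]
    exact Finset.sum_congr rfl fun _ _ => Finset.sum_congr rfl fun _ _ => by ring
  simp_rw [h1]
  rw [Finset.sum_comm, Finset.mul_sum]
  refine Finset.sum_congr rfl fun q _ => ?_
  rw [Finset.sum_comm, Finset.sum_eq_single q]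
  · rw [← Finset.mul_sum]
    have := sum_messages_apply hM (fun i v => φ i v ^ 2) q
    simp only [← sq]
    rw [this]
    ring
  · intro p _ hp
    rw [← Finset.mul_sum, sum_messages_mul hp.symm (hφ q), mul_zero]
  · simp

/-- Mean of the input of user `q` at symbol `n`. -/
def inputMean {N : ℕ} {M : Sizes} (enc : Encoders N M) (q : Fin 3) (n : Fin N) : ℝ :=
  (∑ v, enc q v n) / M q

/-- Variance of the input of user `q` at symbol `n`. -/
def inputVar {N : ℕ} {M : Sizes} (enc : Encoders N M) (q : Fin 3) (n : Fin N) : ℝ :=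
  (∑ v, (enc q v n - inputMean enc q n) ^ 2) / M q

theorem sum_sub_inputMean {N : ℕ} {M : Sizes} (hM : ∀ i, 0 < M i) (enc : Encoders N M)
    (q : Fin 3) (n : Fin N) : ∑ v, (enc q v n - inputMean enc q n) = 0 := by
  have : (M q : ℝ) ≠ 0 := by exact_mod_cast (hM q).ne'
  simp only [Finset.sum_sub_distrib, Finset.sum_const, Finset.card_univ, Fintype.card_fin,
    nsmul_eq_mul, inputMean]
  field_simp
  ring

theorem inputVar_le {N : ℕ} {M : Sizes} (hM : ∀ i, 0 < M i) (enc : Encoders N M)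
    (q : Fin 3) (n : Fin N) : inputVar enc q n ≤ (∑ v, enc q v n ^ 2) / M q := by
  have h0 : (0 : ℝ) ≤ M q := by positivity
  refine div_le_div_of_nonneg_right ?_ h0
  set μ := inputMean enc q n with hμ
  have h1 := sum_sub_inputMean hM enc q n
  have h2 : ∑ v, enc q v n ^ 2 = ∑ v, (enc q v n - μ) ^ 2 +
      2 * μ * ∑ v, (enc q v n - μ) + M q * μ ^ 2 := by
    rw [Finset.mul_sum, ← Finset.sum_add_distrib]
    have : (M q : ℝ) * μ ^ 2 = ∑ _v : Fin (M q), μ ^ 2 := by simp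
    rw [this, ← Finset.sum_add_distrib]
    exact Finset.sum_congr rfl fun _ _ => by ring
  rw [h2, h1]
  have : 0 ≤ (M q : ℝ) * μ ^ 2 := by positivity
  linarith

theorem sum_inputVar_le {N : ℕ} {M : Sizes} (hM : ∀ i, 0 < M i) {enc : Encoders N M} {P : ℝ}
    (hP : totalPower enc ≤ P) : ∑ n, ∑ q, inputVar enc q n ≤ N * P := by
  rcases Nat.eq_zero_or_pos N with rfl | hN
  · simp
  have hN' : (0 : ℝ) < N := by exact_mod_cast hN
  have hcard : (0 : ℝ) < Fintype.card (Messages M) := by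
    rw [Fintype.card_pi]
    push_cast
    exact Finset.prod_pos fun i _ => by simpa using hM i
  have h1 : totalPower enc = 1 / N * ∑ n, ∑ q, (∑ v, enc q v n ^ 2) / M q := by
    rw [totalPower, ← Finset.mul_sum, Finset.sum_comm, div_eq_iff hcard.ne', mul_assoc]
    congr 1
    rw [Finset.sum_comm (f := fun n q => (∑ v, enc q v n ^ 2) / (M q : ℝ)), Finset.sum_mul]
    refine Finset.sum_congr rfl fun q _ => ?_
    rw [Finset.sum_comm, Finset.sum_mul]
    refine Finset.sum_congr rfl fun n _ => ?_
    rw [sum_messages_apply hM (fun i v => enc i v n ^ 2) q, mul_comm]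
  calc ∑ n, ∑ q, inputVar enc q n ≤ ∑ n, ∑ q, (∑ v, enc q v n ^ 2) / (M q : ℝ) :=
        Finset.sum_le_sum fun n _ => Finset.sum_le_sum fun q _ => inputVar_le hM enc q n
    _ = N * totalPower enc := by rw [h1]; field_simp
    _ ≤ N * P := by gcongr

/-- Converse for a code of the multiple access channel. The matrix `T` whitens the noise, and `lam`
are the variances of the comparison law of the whitened output. -/
theorem one_sub_macErrorProb_mul_le {m : ℕ} {H : Matrix (Fin m) (Fin 3) ℝ}
    {K T : Matrix (Fin m) (Fin m) ℝ} (hK : K.PosSemidef) (hT : T * K * Tᵀ = 1)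
    {lam : Fin m → ℝ} (hlam : ∀ r, 0 < lam r) {N : ℕ} {M : Sizes} (hM : ∀ i, 0 < M i)
    (enc : Encoders N M) {dec : (Fin N → Fin m → ℝ) → Messages M} (hdec : Measurable dec) :
    (1 - macErrorProb H K enc dec) * ∑ i, Real.log (M i) ≤
      Real.log 2 + ∑ n, ∑ r, 1 / 2 * (Real.log (lam r) - 1 +
        (1 + ∑ q, (T * H) r q ^ 2 * inputVar enc q n) / lam r) := by
  have : ∀ i, NeZero (M i) := fun i => ⟨(hM i).ne'⟩
  have hcard : (0 : ℝ) < Fintype.card (Messages M) := by exact_mod_cast Fintype.card_pos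
  have hTinv : T⁻¹ * T = 1 := by
    have h1 : T * (K * Tᵀ) = 1 := by rw [← Matrix.mul_assoc]; exact hT
    exact Matrix.nonsing_inv_mul _ (Matrix.isUnit_det_of_right_inverse h1)
  let x (w : Messages M) (n : Fin N) (r : Fin m) : ℝ := ∑ q, (T * H) r q * enc q (w q) n
  let μ (n : Fin N) (r : Fin m) : ℝ := ∑ q, (T * H) r q * inputMean enc q n
  -- Centring `Q` at the mean whitened input makes the squared mean shifts average to input
  -- variances.
  let Q : Measure (Fin N → Fin m → ℝ) :=
    Measure.pi fun n => Measure.pi fun r => gaussianReal (μ n r) (lam r).toNNReal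
  let Pw (w : Messages M) : Measure (Fin N → Fin m → ℝ) :=
    Measure.pi fun n => Measure.pi fun r => gaussianReal (x w n r) 1
  have hratio (w : Messages M) := HasLogRatio.pi fun n => HasLogRatio.pi fun r =>
    hasLogRatio_gaussianReal (x w n r) (μ n r) (hlam r)
  let undo (y : Fin N → Fin m → ℝ) (n : Fin N) (r : Fin m) : ℝ := ∑ s, T⁻¹ r s * y n s
  have hundo : Measurable undo := by fun_prop
  let A (w : Messages M) : Set (Fin N → Fin m → ℝ) := {y | dec (undo y) = w}
  have hA (w : Messages M) : MeasurableSet (A w) :=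
    (hdec.comp hundo) (MeasurableSet.singleton w)
  have hdisj : Pairwise (Function.onFun Disjoint A) := fun w w' hne =>
    Set.disjoint_left.2 fun y hy hy' => hne (hy.symm.trans hy')
  have hmain := log_card_mul_sum_le (P := Pw) (Q := Q) hratio hA hdisj
  have hprob (w : Messages M) : (Pw w).real (A w) =
      1 - (macNoise K N).real {z | dec (macOutput H enc w z) ≠ w} := by
    have hz (z : Fin N → EuclideanSpace ℝ (Fin m)) :
        undo (fun n r => x w n r + ∑ s, T r s * z n s) = macOutput H enc w z := by
      ext n r
      have e : (fun r => x w n r + ∑ s, T r s * z n s) = T *ᵥ macOutput H enc w z n := by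
        have e1 : macOutput H enc w z n = H *ᵥ (fun q => enc q (w q) n) + (z n).ofLp := by
          ext r; rfl
        rw [e1, Matrix.mulVec_add, Matrix.mulVec_mulVec]
        rfl
      change (T⁻¹ *ᵥ fun r => x w n r + ∑ s, T r s * z n s) r = _
      rw [e, Matrix.mulVec_mulVec, hTinv, Matrix.one_mulVec]
    have hout : Measurable fun z => macOutput H enc w z := by
      unfold macOutput; fun_prop
    have hms : MeasurableSet {z | dec (macOutput H enc w z) ≠ w} :=
      (hdec.comp hout) (MeasurableSet.singleton w).compl
    rw [← probReal_compl_eq_one_sub hms]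
    change (Measure.pi fun n => Measure.pi fun r => gaussianReal (x w n r) 1).real (A w) = _
    rw [← macNoise_map_mulVec hK hT, map_measureReal_apply (by fun_prop) (hA w)]
    congr 1
    ext z
    simp only [A, Set.mem_preimage, Set.mem_ofPred_eq, hz, Set.mem_compl_iff, not_not]
  have hlog : Real.log (Fintype.card (Messages M)) = ∑ i, Real.log (M i) := by
    rw [Fintype.card_pi]
    push_cast
    rw [Real.log_prod fun i _ => by simpa using (hM i).ne']
    simp
  have hvar : ∑ w, ∑ n, ∑ r, 1 / 2 * (Real.log (lam r) - 1 + (1 + (x w n r - μ n r) ^ 2) / lam r) =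
      Fintype.card (Messages M) * ∑ n, ∑ r, 1 / 2 * (Real.log (lam r) - 1 +
        (1 + ∑ q, (T * H) r q ^ 2 * inputVar enc q n) / lam r) := by
    rw [Finset.sum_comm, Finset.mul_sum]
    refine Finset.sum_congr rfl fun n _ => ?_
    rw [Finset.sum_comm, Finset.mul_sum]
    refine Finset.sum_congr rfl fun r _ => ?_
    have h1 := sum_messages_sq hM (fun q => sum_sub_inputMean hM enc q n) (fun q => (T * H) r q)
    have h2 (w : Messages M) : x w n r - μ n r =
        ∑ q, (T * H) r q * (enc q (w q) n - inputMean enc q n) := by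
      simp only [x, μ, ← Finset.sum_sub_distrib, mul_sub]
    simp_rw [h2]
    rw [← Finset.mul_sum, Finset.sum_add_distrib, ← Finset.sum_div, Finset.sum_add_distrib, h1]
    simp only [Finset.sum_const, Finset.card_univ, nsmul_eq_mul, inputVar]
    ring
  have herr : ∑ w, (Pw w).real (A w) =
      Fintype.card (Messages M) * (1 - macErrorProb H K enc dec) := by
    simp_rw [hprob]
    rw [macErrorProb, mul_sub, mul_div_cancel₀ _ hcard.ne', Finset.sum_sub_distrib]
    simp
  rw [hvar, herr, hlog] at hmain
  refine le_of_mul_le_mul_left ?_ hcard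
  linarith

/-! ### From codes to the sum capacity -/

/-- Taking `N` so large that `log 2 ≤ N * ε` gives `(1 - 3 * ε) * (∑ R - 3 * ε) ≤ C + ε`; then `ε`
tends to 0. One `3 * ε` comes from the emulation error, the other from the slack of three rates. -/
theorem sum_le_of_forall_code {h : Matrix (Fin 3) (Fin 3) ℝ} {P C : ℝ}
    (hC : ∀ (N : ℕ) (M : Sizes) (enc : Encoders N M) (dec : (i : Fin 3) → (Fin N → ℝ) → Fin (M i)),
      (∀ i, 0 < M i) → (∀ i, Measurable (dec i)) → totalPower enc ≤ P →
      (1 - 3 * icErrorProb h enc dec) * ∑ i, Real.log (M i) ≤ Real.log 2 + N * C)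
    {R : Fin 3 → ℝ} (hR : R ∈ icCapacityRegion h P) : ∑ i, R i ≤ C := by
  have hbound : ∀ ε : ℝ, 0 < ε → ε < 1 / 3 → (1 - 3 * ε) * (∑ i, R i - 3 * ε) ≤ C + ε := by
    intro ε hε hε3
    obtain ⟨N₀, hN₀⟩ := hR ε hε
    obtain ⟨N₁, hN₁⟩ := exists_nat_gt (Real.log 2 / ε)
    set N := max N₀ N₁ with hN
    have hNpos : (0 : ℝ) < N := lt_of_lt_of_le
      ((div_nonneg (Real.log_nonneg one_le_two) hε.le).trans_lt hN₁)
      (by exact_mod_cast le_max_right _ _)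
    have hNε : Real.log 2 ≤ N * ε := by
      rw [← div_le_iff₀ hε]
      exact hN₁.le.trans (by exact_mod_cast le_max_right _ _)
    obtain ⟨M, hM, hrate, enc, dec, hdec, hpow, herr⟩ := hN₀ N (le_max_left _ _)
    have h1 := hC N M enc dec hM hdec hpow
    have h2 : ∑ i, R i - 3 * ε ≤ (∑ i, Real.log (M i)) / N := by
      have : ∑ i, (R i - ε) ≤ ∑ i, Real.log (M i) / N :=
        Finset.sum_le_sum fun i _ => by have := (abs_le.1 (hrate i)).1; linarith
      rw [← Finset.sum_div] at this
      simpa using this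
    have h3 : 0 ≤ ∑ i, Real.log (M i) := Finset.sum_nonneg fun i _ =>
      Real.log_nonneg (by exact_mod_cast hM i)
    have h4 : (1 - 3 * ε) * ∑ i, Real.log (M i) ≤ Real.log 2 + N * C :=
      (mul_le_mul_of_nonneg_right (by linarith) h3).trans h1
    calc (1 - 3 * ε) * (∑ i, R i - 3 * ε) ≤ (1 - 3 * ε) * ((∑ i, Real.log (M i)) / N) := by
          gcongr; linarith
      _ ≤ C + ε := by
          rw [← mul_div_assoc, div_le_iff₀ hNpos]
          linarith
  have hlim : Filter.Tendsto (fun ε : ℝ => C + ε - (1 - 3 * ε) * (∑ i, R i - 3 * ε))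
      (nhdsWithin 0 (Set.Ioi 0)) (nhds (C + 0 - (1 - 3 * 0) * (∑ i, R i - 3 * 0))) :=
    (Continuous.tendsto (by fun_prop) 0).mono_left nhdsWithin_le_nhds
  have := ge_of_tendsto hlim (b := 0) <| by
    filter_upwards [Ioo_mem_nhdsGT (show (0 : ℝ) < 1 / 3 by norm_num)] with ε hε
    linarith [hbound ε hε.1 hε.2]
  linarith

theorem sumCapacity_le {S : Set (Fin 3 → ℝ)} {C : ℝ} (h : ∀ R ∈ S, ∑ i, R i ≤ C) :
    sumCapacity S ≤ (C : EReal) :=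
  iSup₂_le fun R hR => by exact_mod_cast h R hR

/-! ### Whitening -/

theorem exists_orthogonal_diagonalization {n : Type*} [Fintype n] [DecidableEq n]
    {A : Matrix n n ℝ} (hA : A.IsHermitian) :
    ∃ U : Matrix n n ℝ, U * Uᵀ = 1 ∧ U * A * Uᵀ = Matrix.diagonal hA.eigenvalues := by
  refine ⟨star (hA.eigenvectorUnitary : Matrix n n ℝ), ?_, ?_⟩
  · rw [Matrix.star_eq_conjTranspose, Matrix.conjTranspose_eq_transpose_of_trivial,
      Matrix.transpose_transpose, ← Matrix.conjTranspose_eq_transpose_of_trivial,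
      ← Matrix.star_eq_conjTranspose]
    exact Unitary.coe_star_mul_self _
  · have := hA.conjStarAlgAut_star_eigenvectorUnitary
    rw [Unitary.conjStarAlgAut_apply] at this
    simpa [Matrix.star_eq_conjTranspose, Matrix.conjTranspose_eq_transpose_of_trivial] using this

/-- First `K` is normalized to the identity; an orthogonal change of basis then diagonalizes the
transformed `S` and preserves the identity. -/
theorem exists_whitening {n : Type*} [Fintype n] [DecidableEq n] {K S : Matrix n n ℝ}
    (hK : K.PosDef) (hS : S.IsHermitian) :
    ∃ (T : Matrix n n ℝ) (d : n → ℝ), T * K * Tᵀ = 1 ∧ T * S * Tᵀ = Matrix.diagonal d := by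
  obtain ⟨U, -, hUK⟩ := exists_orthogonal_diagonalization hK.isHermitian
  set e := hK.isHermitian.eigenvalues
  have he i : 0 < e i := hK.eigenvalues_pos i
  set T₁ := Matrix.diagonal (fun i => (√(e i))⁻¹) * U with hT₁
  have h1 : T₁ * K * T₁ᵀ = 1 := by
    have : T₁ * K * T₁ᵀ = Matrix.diagonal (fun i => (√(e i))⁻¹) * (U * K * Uᵀ) *
        Matrix.diagonal (fun i => (√(e i))⁻¹) := by
      simp only [hT₁, Matrix.transpose_mul, Matrix.diagonal_transpose, Matrix.mul_assoc]
    rw [this, hUK, Matrix.diagonal_mul_diagonal, Matrix.diagonal_mul_diagonal,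
      ← Matrix.diagonal_one]
    congr 1
    ext i
    have := Real.sqrt_pos.2 (he i)
    have h2 := Real.sq_sqrt (he i).le
    field_simp
    exact h2.symm
  have hA : (T₁ * S * T₁ᵀ).IsHermitian := by
    have hS' : Sᵀ = S := by
      rw [← Matrix.conjTranspose_eq_transpose_of_trivial]; exact hS
    clear_value T₁
    rw [Matrix.IsHermitian, Matrix.conjTranspose_eq_transpose_of_trivial, Matrix.transpose_mul,
      Matrix.transpose_mul, Matrix.transpose_transpose T₁, hS', Matrix.mul_assoc]
  obtain ⟨V, hV, hVA⟩ := exists_orthogonal_diagonalization hA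
  refine ⟨V * T₁, hA.eigenvalues, ?_, ?_⟩
  · have : V * T₁ * K * (V * T₁)ᵀ = V * (T₁ * K * T₁ᵀ) * Vᵀ := by
      simp only [Matrix.transpose_mul, Matrix.mul_assoc]
    rw [this, h1, Matrix.mul_one, hV]
  · rw [← hVA]
    simp only [Matrix.transpose_mul, Matrix.mul_assoc]

/-- A whitening of the noise turns the determinant ratio into a product over parallel channels. -/
theorem exists_whitening_logDetMac (H : Matrix (Fin 2) (Fin 3) ℝ) {K : Matrix (Fin 2) (Fin 2) ℝ}
    (hK : K.PosDef) (P : ℝ) (hP : 0 ≤ P) :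
    ∃ T : Matrix (Fin 2) (Fin 2) ℝ, T * K * Tᵀ = 1 ∧
      logDetMac H K P = ∑ r, Real.log (1 + P / 3 * ∑ q, (T * H) r q ^ 2) := by
  obtain ⟨T, d, hTK, hTS⟩ := exists_whitening hK (Matrix.isHermitian_mul_conjTranspose_self H)
  rw [Matrix.conjTranspose_eq_transpose_of_trivial] at hTS
  refine ⟨T, hTK, ?_⟩
  have hd r : d r = ∑ q, (T * H) r q ^ 2 := by
    have h1 : T * (H * Hᵀ) * Tᵀ = (T * H) * (T * H)ᵀ := by
      simp only [Matrix.transpose_mul, Matrix.mul_assoc]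
    have h2 := congrFun (congrFun (h1.symm.trans hTS) r) r
    rw [Matrix.diagonal_apply_eq, Matrix.mul_apply] at h2
    rw [← h2]
    exact Finset.sum_congr rfl fun q _ => by rw [Matrix.transpose_apply, sq]
  have hdet1 : T.det * K.det * T.det = 1 := by
    have := congrArg Matrix.det hTK
    simpa using this
  have hdet2 : T.det * (K + (P / 3) • (H * Hᵀ)).det * T.det = ∏ r, (1 + P / 3 * d r) := by
    have h1 : T * (K + (P / 3) • (H * Hᵀ)) * Tᵀ = Matrix.diagonal fun r => 1 + P / 3 * d r := by
      rw [Matrix.mul_add, Matrix.add_mul, hTK, Matrix.mul_smul, Matrix.smul_mul, hTS,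
        ← Matrix.diagonal_one, ← Matrix.diagonal_smul, Matrix.diagonal_add]
      rfl
    have := congrArg Matrix.det h1
    simpa using this
  have hKdet : K.det ≠ 0 := hK.det_pos.ne'
  have hratio : (K + (P / 3) • (H * Hᵀ)).det / K.det = ∏ r, (1 + P / 3 * d r) := by
    rw [← hdet2, div_eq_iff hKdet]
    linear_combination (-(K + (P / 3) • (H * Hᵀ)).det) * hdet1
  rw [logDetMac, hratio, Real.log_prod]
  · simp_rw [hd]
  · intro r _
    rw [hd]
    positivity

/-! ### Emulating receivers -/

/-- The outer bound for the enhanced receiver `i`. -/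
theorem exists_emulates_enhancedGains {h : Matrix (Fin 3) (Fin 3) ℝ} (hh : ∀ i j, h i j ≠ 0)
    {i j k : Fin 3} (hij : i ≠ j) (hjk : j ≠ k) (hik : i ≠ k) {a : Fin 3 → ℝ} {α β : ℝ}
    (hal : Aligned h a α β i j k) {K : Matrix (Fin 2) (Fin 2) ℝ} (hK : K.PosSemidef)
    (h1 : K 0 0 ≤ 1) (h2 : combVar K α β ≤ (combGain h a α β i j / h j j) ^ 2)
    (h3 : K 0 0 ≤ (h i k / h k k) ^ 2) : ∃ b, Emulates h (enhancedGains h a i) K i j k b := by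
  obtain ⟨hu, hal⟩ := hal
  set u := combGain h a α β i j with hudef
  have hjj := hh j j
  have hkk := hh k k
  have hikne := hh i k
  -- The weights for `j` rescale `U` so that `X_j` gets gain `h j j`, and alignment then gives `X_k`
  -- gain `h j k`. For `k` the first antenna is rescaled. The bounds `h1`, `h2`, `h3` are the noise
  -- conditions for `i`, `j`, `k`.
  refine ⟨fun l => if l = i then ![1, 0] else if l = j then ![h j j / u * α, h j j / u * β]
    else ![h k k / h i k, 0], hK, hij, hjk, hik, fun l => ?_, fun l => ?_, fun l hl => ?_, ?_⟩
  · split_ifs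
    · simpa [Matrix.mulVec, dotProduct, Fin.sum_univ_two] using h1
    · have e : ![h j j / u * α, h j j / u * β] ⬝ᵥ K *ᵥ ![h j j / u * α, h j j / u * β] =
          combVar K α β / (u / h j j) ^ 2 := by
        simp only [combVar, Matrix.mulVec, dotProduct, Fin.sum_univ_two, Matrix.cons_val_zero,
          Matrix.cons_val_one]
        field_simp
      rw [e]
      exact div_le_one_of_le₀ h2 (by positivity)
    · have e : ![h k k / h i k, 0] ⬝ᵥ K *ᵥ ![h k k / h i k, 0] =
          K 0 0 / (h i k / h k k) ^ 2 := by
        simp only [Matrix.mulVec, dotProduct, Fin.sum_univ_two, Matrix.cons_val_zero,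
          Matrix.cons_val_one]
        field_simp
        ring
      rw [e]
      exact div_le_one_of_le₀ h3 (by positivity)
  · simp [enhancedGains, Matrix.vecMul, dotProduct, Fin.sum_univ_two]
  · have hlv : (![h j j / u * α, h j j / u * β] ᵥ* enhancedGains h a i) l =
        h j j * (combGain h a α β i l / u) := by
      simp only [enhancedGains, Matrix.vecMul, dotProduct, Fin.sum_univ_two, Matrix.cons_val_zero,
        Matrix.cons_val_one, Matrix.of_apply, combGain]
      ring
    simp only [hij.symm, if_false, if_true, hlv]
    rcases (by omega : l = j ∨ l = k) with rfl | rfl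
    · rw [← hudef, div_self hu, mul_one]
    · rw [hal]; field_simp
  · simp [enhancedGains, Matrix.vecMul, dotProduct, Fin.sum_univ_two, hik.symm, hjk.symm, hikne]

/-- Without a genie, when the gains are already aligned. -/
theorem exists_emulates_row {h : Matrix (Fin 3) (Fin 3) ℝ} (hh : ∀ i j, h i j ≠ 0)
    {i j k : Fin 3} (hij : i ≠ j) (hjk : j ≠ k) (hik : i ≠ k)
    (hal : h i k / h i j = h j k / h j j) {t : ℝ} (ht0 : 0 ≤ t) (h1 : t ≤ 1)
    (h2 : t ≤ (h i j / h j j) ^ 2) (h3 : t ≤ (h i k / h k k) ^ 2) :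
    ∃ b, Emulates h (Matrix.of ![h i]) !![t] i j k b := by
  have hjj := hh j j
  have hkk := hh k k
  have hikne := hh i k
  have hijne := hh i j
  have hK : (!![t] : Matrix (Fin 1) (Fin 1) ℝ).PosSemidef := by
    have : (!![t] : Matrix (Fin 1) (Fin 1) ℝ) = Matrix.diagonal fun _ => t := by
      ext a b
      simp [Subsingleton.elim a b]
    rw [this]
    exact Matrix.PosSemidef.diagonal fun _ => ht0
  refine ⟨fun l => if l = i then ![1] else if l = j then ![h j j / h i j]
    else ![h k k / h i k], hK, hij, hjk, hik, fun l => ?_, fun l => ?_, fun l hl => ?_, ?_⟩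
  · split_ifs
    · simpa [Matrix.mulVec, dotProduct] using h1
    · have e : ![h j j / h i j] ⬝ᵥ !![t] *ᵥ ![h j j / h i j] = t / (h i j / h j j) ^ 2 := by
        simp [Matrix.mulVec, dotProduct]
        field_simp
      rw [e]
      exact div_le_one_of_le₀ h2 (by positivity)
    · have e : ![h k k / h i k] ⬝ᵥ !![t] *ᵥ ![h k k / h i k] = t / (h i k / h k k) ^ 2 := by
        simp [Matrix.mulVec, dotProduct]
        field_simp
      rw [e]
      exact div_le_one_of_le₀ h3 (by positivity)
  · simp [Matrix.vecMul, dotProduct]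
  · have hlv : (![h j j / h i j] ᵥ* Matrix.of ![h i]) l = h j j * (h i l / h i j) := by
      simp [Matrix.vecMul, dotProduct]
      ring
    simp only [hij.symm, if_false, if_true, hlv]
    rcases (by omega : l = j ∨ l = k) with rfl | rfl
    · field_simp
    · rw [hal]; field_simp
  · simp [Matrix.vecMul, dotProduct, hik.symm, hjk.symm, hikne]

theorem exists_aligned {h : Matrix (Fin 3) (Fin 3) ℝ} (hh : ∀ i j, h i j ≠ 0)
    {i j k : Fin 3} {a : Fin 3 → ℝ} (ha : h i j * a k ≠ h i k * a j) :
    ∃ α β : ℝ, Aligned h a α β i j k := by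
  have hD : h i j * a k - h i k * a j ≠ 0 := sub_ne_zero.2 ha
  have hjj := hh j j
  have e1 : combGain h a (h j j * a k - h j k * a j) (h i j * h j k - h i k * h j j) i j =
      h j j * (h i j * a k - h i k * a j) := by rw [combGain]; ring
  have e2 : combGain h a (h j j * a k - h j k * a j) (h i j * h j k - h i k * h j j) i k =
      h j k * (h i j * a k - h i k * a j) := by rw [combGain]; ring
  -- Cramer's rule, without division, for gains of `X_j`, `X_k` proportional to `(h j j, h j k)`.
  refine ⟨h j j * a k - h j k * a j, h i j * h j k - h i k * h j j, ?_, ?_⟩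
  · rw [e1]; exact mul_ne_zero hjj hD
  · rw [e1, e2, mul_div_mul_right _ _ hD]

/-- The nonnegative determinant bounds the covariance by `√(t * s)`, whatever the correlation. -/
theorem combVar_le {K : Matrix (Fin 2) (Fin 2) ℝ} (hK : K.PosSemidef) {s t : ℝ}
    (ht : K 0 0 ≤ t) (hs : K 1 1 ≤ s) (α β : ℝ) :
    combVar K α β ≤ α ^ 2 * t + 2 * |α * β| * √(t * s) + β ^ 2 * s := by
  have hsymm : K 1 0 = K 0 1 := by simpa using (hK.isHermitian.apply 0 1)
  have h00 : 0 ≤ K 0 0 := hK.diag_nonneg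
  have h11 : 0 ≤ K 1 1 := hK.diag_nonneg
  have hdet := hK.det_nonneg
  rw [Matrix.det_fin_two, hsymm] at hdet
  have h01 : |K 0 1| ≤ √(t * s) := by
    refine Real.abs_le_sqrt ?_
    calc K 0 1 ^ 2 ≤ K 0 0 * K 1 1 := by nlinarith
      _ ≤ t * s := mul_le_mul ht hs h11 (h00.trans ht)
  have e : combVar K α β = α ^ 2 * K 0 0 + 2 * (α * β * K 0 1) + β ^ 2 * K 1 1 := by
    simp only [combVar, Matrix.mulVec, dotProduct, Fin.sum_univ_two, Matrix.cons_val_zero,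
      Matrix.cons_val_one, hsymm]
    ring
  have h4 : α * β * K 0 1 ≤ |α * β| * √(t * s) :=
    (le_abs_self _).trans (by rw [abs_mul]; gcongr)
  rw [e]
  have h5 : α ^ 2 * K 0 0 ≤ α ^ 2 * t := by gcongr
  have h6 : β ^ 2 * K 1 1 ≤ β ^ 2 * s := by gcongr
  linarith

/-- As `t` decreases to 0, the bound of `combVar_le` tends to `β ^ 2 * s`. -/
theorem exists_noise_level (α β s A B : ℝ) (hA : β ^ 2 * s < A) (hB : 0 < B) :
    ∃ t : ℝ, 0 < t ∧ t ≤ 1 ∧ t ≤ B ∧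
      α ^ 2 * t + 2 * |α * β| * √(t * s) + β ^ 2 * s ≤ A := by
  have hcont : Filter.Tendsto (fun t : ℝ => α ^ 2 * t + 2 * |α * β| * √(t * s) + β ^ 2 * s)
      (nhdsWithin 0 (Set.Ioi 0)) (nhds (α ^ 2 * 0 + 2 * |α * β| * √(0 * s) + β ^ 2 * s)) :=
    (Continuous.tendsto (by fun_prop) 0).mono_left nhdsWithin_le_nhds
  have h1 := hcont.eventually_le_const (u := A) (by simpa using hA)
  have h2 : ∀ᶠ t in nhdsWithin (0 : ℝ) (Set.Ioi 0), t ∈ Set.Ioo 0 (min 1 B) :=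
    Ioo_mem_nhdsGT (lt_min one_pos hB)
  obtain ⟨t, h1, h2⟩ := (h1.and h2).exists
  exact ⟨t, h2.1, h2.2.le.trans (min_le_left _ _), h2.2.le.trans (min_le_right _ _), h1⟩

/-! ### Single-antenna converse -/

/-- Squared gains are all 1, so the output variance depends only on the total power. The converse
applies with `T = 1` and comparison variance `1 + P`, and no symmetrization is needed. -/
theorem sum_le_half_log {h : Matrix (Fin 3) (Fin 3) ℝ} {i j k r : Fin 3} {b : Fin 3 → Fin 1 → ℝ}
    (hE : Emulates h (Matrix.of ![h r]) !![1] i j k b) (hr : ∀ q, h r q ^ 2 = 1) {P : ℝ}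
    (hP : 0 ≤ P) {R : Fin 3 → ℝ} (hR : R ∈ icCapacityRegion h P) :
    ∑ i, R i ≤ 1 / 2 * Real.log (1 + P) := by
  refine sum_le_of_forall_code (fun N M enc dec hM hdec hpow => ?_) hR
  obtain ⟨dec', hdec', herr⟩ := hE.exists_decoder enc hdec
  have hK1 : (!![1] : Matrix (Fin 1) (Fin 1) ℝ) = 1 := by
    ext a b
    fin_cases a
    fin_cases b
    rfl
  have hP1 : 0 < 1 + P := by linarith
  have hmain := one_sub_macErrorProb_mul_le (H := Matrix.of ![h r]) (T := (1 : Matrix (Fin 1) (Fin 1) ℝ)) hE.posSemidef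
    (by rw [hK1]; simp)
    (lam := fun _ => 1 + P) (fun _ => hP1) hM enc hdec'
  have hlog : 0 ≤ ∑ i, Real.log (M i) := Finset.sum_nonneg fun i _ =>
    Real.log_nonneg (by exact_mod_cast hM i)
  refine (mul_le_mul_of_nonneg_right (sub_le_sub_left herr 1) hlog).trans (hmain.trans ?_)
  have hpow' := sum_inputVar_le hM hpow
  have e : ∑ n : Fin N, ∑ s : Fin 1, 1 / 2 * (Real.log (1 + P) - 1 +
      (1 + ∑ q, ((1 : Matrix (Fin 1) (Fin 1) ℝ) * Matrix.of ![h r]) s q ^ 2 * inputVar enc q n) /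
        (1 + P)) =
      1 / 2 * (N * (Real.log (1 + P) - 1) + (N + ∑ n, ∑ q, inputVar enc q n) / (1 + P)) := by
    simp [hr, ← Finset.mul_sum, Finset.sum_add_distrib, ← Finset.sum_div]
    ring
  rw [e]
  have h5 : (N + ∑ n, ∑ q, inputVar enc q n) / (1 + P) ≤ N := by
    rw [div_le_iff₀ hP1]; linarith
  linarith

/-! ### The symmetric channel -/

theorem symmetricGains_apply (c : ℝ) (p q : Fin 3) :
    symmetricGains c p q = if p = q then 1 else c := by
  fin_cases p <;> fin_cases q <;> simp [symmetricGains]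

theorem symmetricMacGains_zero_apply (c a₁ : ℝ) (q : Fin 3) :
    symmetricMacGains c a₁ 0 q = if 0 = q then 1 else c := by
  fin_cases q <;> simp [symmetricMacGains]

theorem symmetricMacGains_add_apply (c a₁ : ℝ) {q : Fin 3} (hq : q ≠ 0) :
    symmetricMacGains c a₁ 0 q + symmetricMacGains c a₁ 1 q = if 1 = q then 1 else c := by
  fin_cases q <;> simp [symmetricMacGains] at hq ⊢

/-- Any relabelling of the users of the symmetric channel gives an emulating receiver. -/
theorem emulates_symmetric {c : ℝ} (hc : 1 < c) (a₁ : ℝ) {K : Matrix (Fin 2) (Fin 2) ℝ}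
    (hK : K.PosSemidef) (h00 : K 0 0 = 1) (h11 : combVar K 1 1 ≤ 1) (σ : Equiv.Perm (Fin 3)) :
    Emulates (symmetricGains c) ((symmetricMacGains c a₁).submatrix id σ) K
      (σ.symm 0) (σ.symm 1) (σ.symm 2)
      (fun l => (![![1, 0], ![1, 1], ![1 / c, 0]] : Fin 3 → Fin 2 → ℝ) (σ l)) := by
  have hsym (p l : Fin 3) : symmetricGains c (σ.symm p) l = if p = σ l then 1 else c := by
    rw [symmetricGains_apply]
    simp only [Equiv.symm_apply_eq]
  -- The antennas sum to gains `(1 + a₁, 1, c)`, which match the second receiver apart from the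
  -- first user; the weight `1 / c` turns the third user's gain `c` into 1.
  refine ⟨hK, by simp, by simp, by simp, fun l => ?_, fun l => ?_, fun l hl => ?_, ?_⟩
  · generalize σ l = p
    fin_cases p
    · simp [Matrix.mulVec, dotProduct, Fin.sum_univ_two, h00]
    · simpa [combVar] using h11
    · simp [Matrix.mulVec, dotProduct, Fin.sum_univ_two, h00]
      rw [← mul_inv]
      exact inv_le_one_of_one_le₀ (by nlinarith)
  · rw [hsym, ← symmetricMacGains_zero_apply c a₁]
    simp [Matrix.vecMul, dotProduct, Fin.sum_univ_two]
  · rw [hsym, ← symmetricMacGains_add_apply c a₁ fun h => hl (by rw [← h, σ.symm_apply_apply])]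
    simp [Matrix.vecMul, dotProduct, Fin.sum_univ_two]
  · rw [symmetricGains_apply, if_pos rfl]
    have : c ≠ 0 := by linarith
    simp [Matrix.vecMul, dotProduct, Fin.sum_univ_two, symmetricMacGains, this]

theorem sum_le_half_logDetMac {c : ℝ} (hc : 1 < c) (a₁ : ℝ) {K : Matrix (Fin 2) (Fin 2) ℝ}
    (hK : K.PosDef) (h00 : K 0 0 = 1) (h11 : combVar K 1 1 ≤ 1) {P : ℝ} (hP : 0 ≤ P)
    {R : Fin 3 → ℝ} (hR : R ∈ icCapacityRegion (symmetricGains c) P) :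
    ∑ i, R i ≤ 1 / 2 * logDetMac (symmetricMacGains c a₁) K P := by
  obtain ⟨T, hT, hlogdet⟩ := exists_whitening_logDetMac (symmetricMacGains c a₁) hK P hP
  refine sum_le_of_forall_code (fun N M enc dec hM hdec hpow => ?_) hR
  set G : Matrix (Fin 2) (Fin 3) ℝ := T * symmetricMacGains c a₁ with hG
  set lam : Fin 2 → ℝ := fun r => 1 + P / 3 * ∑ q, G r q ^ 2 with hlam
  have hlam0 r : 0 < lam r := by
    simp only [hlam]; positivity
  have hlog : 0 ≤ ∑ i, Real.log (M i) := Finset.sum_nonneg fun i _ =>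
    Real.log_nonneg (by exact_mod_cast hM i)
  -- The same code is bounded through each of the three cyclic relabellings, always with the
  -- comparison variances `lam` of equal powers `P / 3`.
  have hσ (t : Fin 3) : (1 - 3 * icErrorProb (symmetricGains c) enc dec) * ∑ i, Real.log (M i) ≤
      Real.log 2 + ∑ n : Fin N, ∑ r, 1 / 2 * (Real.log (lam r) - 1 +
        (1 + ∑ q, G r (q + t) ^ 2 * inputVar enc q n) / lam r) := by
    obtain ⟨dec', hdec', herr⟩ := (emulates_symmetric hc a₁ hK.posSemidef h00 h11
      (Equiv.addRight t)).exists_decoder enc hdec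
    exact (mul_le_mul_of_nonneg_right (sub_le_sub_left herr 1) hlog).trans
      (one_sub_macErrorProb_mul_le hK.posSemidef hT hlam0 hM enc hdec')
  -- Over the three shifts each user meets every column of `G` once, so only the total variance
  -- remains.
  have hcyc (r : Fin 2) (n : Fin N) : ∑ t, ∑ q, G r (q + t) ^ 2 * inputVar enc q n =
      (∑ q, G r q ^ 2) * ∑ q, inputVar enc q n := by
    rw [Finset.sum_comm, Finset.mul_sum]
    refine Finset.sum_congr rfl fun q _ => ?_
    rw [← Finset.sum_mul]
    congr 1
    exact Equiv.sum_comp (Equiv.addLeft q) fun s => G r s ^ 2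
  have hpow' := sum_inputVar_le hM hpow
  have hsum := Finset.sum_le_sum fun t (_ : t ∈ Finset.univ) => hσ t
  have e : ∑ t : Fin 3, (Real.log 2 + ∑ n : Fin N, ∑ r, 1 / 2 * (Real.log (lam r) - 1 +
        (1 + ∑ q, G r (q + t) ^ 2 * inputVar enc q n) / lam r)) =
      3 * Real.log 2 + ∑ r, 1 / 2 * (3 * N * (Real.log (lam r) - 1) +
        (3 * N + (∑ q, G r q ^ 2) * ∑ n, ∑ q, inputVar enc q n) / lam r) := by
    rw [Finset.sum_add_distrib]
    congr 1
    · simp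
    refine (Finset.sum_comm.trans ((Finset.sum_congr rfl fun n _ => Finset.sum_comm).trans
      Finset.sum_comm)).trans (Finset.sum_congr rfl fun r _ => ?_)
    have hn (n : Fin N) : ∑ t : Fin 3, 1 / 2 * (Real.log (lam r) - 1 +
        (1 + ∑ q, G r (q + t) ^ 2 * inputVar enc q n) / lam r) =
        1 / 2 * (3 * (Real.log (lam r) - 1) +
          (3 + (∑ q, G r q ^ 2) * ∑ q, inputVar enc q n) / lam r) := by
      rw [← hcyc, ← Finset.mul_sum, Finset.sum_add_distrib, ← Finset.sum_div,
        Finset.sum_add_distrib]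
      simp
      ring
    simp_rw [hn]
    rw [Finset.mul_sum (f := fun n => ∑ q, inputVar enc q n), ← Finset.mul_sum, Finset.sum_add_distrib, ← Finset.sum_div, Finset.sum_add_distrib]
    simp
    ring
  rw [e] at hsum
  have hterm (r : Fin 2) : (3 * N + (∑ q, G r q ^ 2) * ∑ n, ∑ q, inputVar enc q n) / lam r ≤
      3 * N := by
    rw [div_le_iff₀ (hlam0 r)]
    have : (∑ q, G r q ^ 2) * ∑ n, ∑ q, inputVar enc q n ≤ (∑ q, G r q ^ 2) * (N * P) := by
      gcongr
    simp only [hlam]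
    linarith
  have hle : ∑ r, 1 / 2 * (3 * N * (Real.log (lam r) - 1) +
        (3 * N + (∑ q, G r q ^ 2) * ∑ n, ∑ q, inputVar enc q n) / lam r) ≤
      ∑ r, 1 / 2 * (3 * N * Real.log (lam r)) :=
    Finset.sum_le_sum fun r _ => by linarith [hterm r]
  have hlog3 : ∑ r, 1 / 2 * (3 * N * Real.log (lam r)) =
      1 / 2 * (3 * N * logDetMac (symmetricMacGains c a₁) K P) := by
    rw [hlogdet, Finset.mul_sum, Finset.mul_sum]
  simp only [Finset.sum_const, Finset.card_univ, Fintype.card_fin, nsmul_eq_mul] at hsum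
  push_cast at hsum
  linarith

/-! ### The best genie for the symmetric channel -/

/-- The determinant ratio for noise correlation `r` and genie noise power `q`. -/
theorem logDetMac_symmetric (c a₁ P : ℝ) {K : Matrix (Fin 2) (Fin 2) ℝ} (hK : K.PosDef)
    (h00 : K 0 0 = 1) :
    logDetMac (symmetricMacGains c a₁) K P =
      Real.log (((1 + P / 3 * (1 + 2 * c ^ 2)) * (K 1 1 + P / 3 * (a₁ ^ 2 + (c - 1) ^ 2)) -
        (K 0 1 + P / 3 * (a₁ - c * (c - 1))) ^ 2) / (K 1 1 - K 0 1 ^ 2)) := by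
  have hsymm : K 1 0 = K 0 1 := by simpa using hK.isHermitian.apply 0 1
  rw [logDetMac]
  congr 1
  rw [Matrix.det_fin_two, Matrix.det_fin_two]
  simp only [symmetricMacGains, Matrix.add_apply, Matrix.smul_apply, Matrix.mul_apply,
    Fin.sum_univ_three, Matrix.transpose_apply, h00, hsymm, smul_eq_mul, Matrix.of_apply,
    Matrix.cons_val_zero, Matrix.cons_val_one, Matrix.cons_val]
  congr 1
  · ring
  · ring

theorem combVar_one_one {K : Matrix (Fin 2) (Fin 2) ℝ} (hK : K.IsHermitian) :
    combVar K 1 1 = K 0 0 + 2 * K 0 1 + K 1 1 := by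
  have hsymm : K 1 0 = K 0 1 := by simpa using hK.apply 0 1
  simp only [combVar, Matrix.mulVec, dotProduct, Fin.sum_univ_two, Matrix.cons_val_zero,
    Matrix.cons_val_one, hsymm]
  ring

/-- The minimum over the genie gain `a₁`, attained at `(r - p * c * (c - 1)) / (1 + 2 * p * c ^ 2)`. -/
theorem symmetric_numerator (p c a q r : ℝ) (hp : 0 ≤ p) :
    (1 + p * (1 + 2 * c ^ 2)) * (q + p * (a ^ 2 + (c - 1) ^ 2)) -
        (r + p * (a - c * (c - 1))) ^ 2 =
      p * (1 + 2 * p * c ^ 2) * (a - (r - p * c * (c - 1)) / (1 + 2 * p * c ^ 2)) ^ 2 +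
      (1 + p * (1 + 2 * c ^ 2)) / (1 + 2 * p * c ^ 2) * ((q - r ^ 2) + (2 * p * c ^ 2 * q +
        p * (c - 1) ^ 2 * (1 + p * c ^ 2) + 2 * p * c * (c - 1) * r)) := by
  have hB : 1 + 2 * p * c ^ 2 ≠ 0 := by positivity
  field_simp
  ring

/-- `-2 * r` is the best genie noise power for the correlation `r`, and `-ρ` the best
correlation. -/
theorem symmetric_excess_ge {p c m ρ q r : ℝ} (hp : 0 ≤ p) (hm : 0 ≤ m)
    (hu : 2 * p * c * (c + 1) = 2 * m * (1 - ρ))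
    (hv : p * (c - 1) ^ 2 * (1 + p * c ^ 2) = m * ρ ^ 2) (hr : r ^ 2 < q) (hq : q ≤ -2 * r) :
    m * (q - r ^ 2) ≤ 2 * p * c ^ 2 * q + p * (c - 1) ^ 2 * (1 + p * c ^ 2) +
      2 * p * c * (c - 1) * r := by
  have hend : 2 * p * c ^ 2 * (-2 * r) + p * (c - 1) ^ 2 * (1 + p * c ^ 2) +
      2 * p * c * (c - 1) * r = m * (-2 * r - r ^ 2) + m * (r + ρ) ^ 2 := by
    linear_combination hv - r * hu
  have hlow : 0 ≤ 2 * p * c ^ 2 * r ^ 2 + p * (c - 1) ^ 2 * (1 + p * c ^ 2) +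
      2 * p * c * (c - 1) * r := by
    have : 2 * p * c ^ 2 * r ^ 2 + p * (c - 1) ^ 2 * (1 + p * c ^ 2) + 2 * p * c * (c - 1) * r =
        p * (2 * (c * r + (c - 1) / 2) ^ 2 + (c - 1) ^ 2 / 2 + p * (c * (c - 1)) ^ 2) := by ring
    rw [this]
    positivity
  have hX : 0 < -2 * r - r ^ 2 := by linarith
  have h1 : m * (-2 * r - r ^ 2) ≤ 2 * p * c ^ 2 * (-2 * r) +
      p * (c - 1) ^ 2 * (1 + p * c ^ 2) + 2 * p * c * (c - 1) * r := by
    rw [hend]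
    have : 0 ≤ m * (r + ρ) ^ 2 := by positivity
    linarith
  -- Both sides are affine in `q`, so the endpoints `q = r ^ 2` (`hlow`) and `q = -2 * r` (`h1`)
  -- suffice; multiplying by the length of this interval clears the interpolation weights.
  refine le_of_mul_le_mul_right ?_ hX
  nlinarith [mul_le_mul_of_nonneg_left h1 (sub_nonneg.2 hr.le),
    mul_nonneg hlow (sub_nonneg.2 hq)]

/-- These equations make `v - r * u - m * (-2 * r - r ^ 2)` equal to `m * (r + ρ) ^ 2`, so `m` is
the least value of the quotient on the boundary `q = -2 * r`. Eliminating `m` leaves `u * ρ ^ 2 = 2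
* v * (1 - ρ)`, whose positive root is taken. -/
theorem exists_symmetric_minimizer {u v : ℝ} (hu : 0 < u) (hv : 0 < v) :
    ∃ m ρ : ℝ, 0 < m ∧ 0 < ρ ∧ ρ < 1 ∧ u = 2 * m * (1 - ρ) ∧ v = m * ρ ^ 2 := by
  have hs0 : 0 ≤ v ^ 2 + 2 * u * v := by positivity
  set s := √(v ^ 2 + 2 * u * v) with hs
  have hs2 : s ^ 2 = v ^ 2 + 2 * u * v := Real.sq_sqrt hs0
  have hsv : v < s := by
    rw [hs]; exact Real.lt_sqrt_of_sq_lt (by nlinarith [mul_pos hu hv])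
  set ρ := (s - v) / u with hρ
  have hρ0 : 0 < ρ := div_pos (by linarith) hu
  have hroot : u * ρ ^ 2 = 2 * v * (1 - ρ) := by
    rw [hρ]; field_simp; linear_combination hs2
  have hρ1 : ρ < 1 := by
    by_contra hcon
    have : 2 * v * (1 - ρ) ≤ 0 := mul_nonpos_of_nonneg_of_nonpos (by linarith) (by linarith)
    have : 0 < u * ρ ^ 2 := by positivity
    linarith
  refine ⟨v / ρ ^ 2, ρ, by positivity, hρ0, hρ1, ?_, ?_⟩
  · field_simp; linarith
  · field_simp

theorem exists_isLeast_symmetricBounds {c P : ℝ} (hc : 1 < c) (hP : 0 ≤ P) :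
    ∃ m, IsLeast (symmetricBounds c P) m := by
  set p := P / 3 with hp
  have hp0 : 0 ≤ p := by positivity
  obtain ⟨m, ρ, hm, hρ0, hρ1, hu, hv⟩ : ∃ m ρ : ℝ, 0 ≤ m ∧ 0 < ρ ∧ ρ ≤ 1 ∧
      2 * p * c * (c + 1) = 2 * m * (1 - ρ) ∧
      p * (c - 1) ^ 2 * (1 + p * c ^ 2) = m * ρ ^ 2 := by
    rcases hp0.eq_or_lt with h | h
    -- At zero power the determinant ratio is constantly 1; the choice `ρ = 1` keeps the covariance
    -- below nonsingular.
    · exact ⟨0, 1, le_rfl, one_pos, le_rfl, by simp [← h], by simp [← h]⟩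
    · have hc1 : 0 < c - 1 := by linarith
      have hc0 : 0 < c := by linarith
      obtain ⟨m, ρ, h1, h2, h3, h4, h5⟩ := exists_symmetric_minimizer
        (u := 2 * p * c * (c + 1)) (v := p * (c - 1) ^ 2 * (1 + p * c ^ 2))
        (by positivity) (by positivity)
      exact ⟨m, ρ, h1.le, h2, h3.le, h4, h5⟩
  have hB : 0 < 1 + 2 * p * c ^ 2 := by positivity
  set κ := (1 + p * (1 + 2 * c ^ 2)) / (1 + 2 * p * c ^ 2) with hκ
  have hκ0 : 0 < κ := by positivity
  refine ⟨Real.log (κ * (1 + m)), ?_, ?_⟩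
  -- Correlation `r = -ρ` and genie power `q = -2 * r` give equality in the variance constraint; the
  -- gain chosen below makes the square in `symmetric_numerator` vanish.
  · set K : Matrix (Fin 2) (Fin 2) ℝ := !![1, -ρ; -ρ, 2 * ρ] with hKdef
    have hherm : K.IsHermitian := by
      ext a b
      fin_cases a <;> fin_cases b <;> simp [hKdef]
    have hKpos : K.PosDef := by
      refine Matrix.PosDef.of_dotProduct_mulVec_pos hherm fun x hx => ?_
      have e : star x ⬝ᵥ K *ᵥ x = (x 0 - ρ * x 1) ^ 2 + ρ * (2 - ρ) * x 1 ^ 2 := by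
        simp [hKdef, Matrix.mulVec, dotProduct, Fin.sum_univ_two]
        ring
      rw [e]
      have hρ2 : 0 < ρ * (2 - ρ) := mul_pos hρ0 (by linarith)
      by_cases h1 : x 1 = 0
      · have h0 : x 0 ≠ 0 := fun h0 => hx (by ext a; fin_cases a <;> simp [h0, h1])
        rw [h1]
        simpa using pow_pos (abs_pos.2 h0) 2
      · positivity
    refine ⟨(-ρ - p * c * (c - 1)) / (1 + 2 * p * c ^ 2), K, hKpos, rfl, ?_, ?_⟩
    · rw [combVar_one_one hherm]
      simp [hKdef]
    · rw [logDetMac_symmetric c _ P hKpos rfl, ← hp, symmetric_numerator _ _ _ _ _ hp0]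
      have e0 : K 0 1 = -ρ := rfl
      have e1 : K 1 1 = 2 * ρ := rfl
      have hne : 2 * ρ - (-ρ) ^ 2 ≠ 0 := by nlinarith
      rw [e0, e1, sub_self, ← hκ]
      congr 1
      rw [eq_div_iff hne]
      linear_combination (-κ) * hv - κ * ρ * hu
  · rintro v ⟨a, K, hK, h00, h11, rfl⟩
    rw [combVar_one_one hK.isHermitian, h00] at h11
    have hdet := hK.det_pos
    have hsymm : K 1 0 = K 0 1 := by simpa using hK.isHermitian.apply 0 1
    rw [Matrix.det_fin_two, h00, hsymm] at hdet
    have hr : K 0 1 ^ 2 < K 1 1 := by linarith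
    rw [logDetMac_symmetric c a P hK h00, ← hp, symmetric_numerator _ _ _ _ _ hp0]
    refine Real.log_le_log (by positivity) ?_
    rw [le_div_iff₀ (sub_pos.2 hr), ← hκ]
    have h1 := symmetric_excess_ge hp0 hm hu hv hr (by linarith)
    have h2 := mul_le_mul_of_nonneg_left h1 hκ0.le
    have h3 : 0 ≤ p * (1 + 2 * p * c ^ 2) *
        (a - (K 0 1 - p * c * (c - 1)) / (1 + 2 * p * c ^ 2)) ^ 2 := by positivity
    linarith

/-! ### The two carriers -/

theorem carrier_bounds {h : Matrix (Fin 3) (Fin 3) ℝ} (hh : h = carrierOne ∨ h = carrierTwo)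
    {P : ℝ} (hP : 0 ≤ P) :
    icCapacityRegion h P ⊆ macCapacityRegion (Matrix.of ![h 0]) !![1] P ∧
      sumCapacity (icCapacityRegion h P) ≤ ((1 / 2 * Real.log (1 + P) : ℝ) : EReal) := by
  have hsq : ∀ i j, h i j ^ 2 = 1 := by
    rcases hh with rfl | rfl <;> intro i j <;> fin_cases i <;> fin_cases j <;>
      simp [carrierOne, carrierTwo]
  have hne : ∀ i j, h i j ≠ 0 := fun i j h0 => by simpa [h0] using hsq i j
  have hle i j k l : (1 : ℝ) ≤ (h i j / h k l) ^ 2 := by simp [div_pow, hsq]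
  obtain ⟨j, k, h0j, hjk, h0k, hal⟩ : ∃ j k : Fin 3, 0 ≠ j ∧ j ≠ k ∧ 0 ≠ k ∧
      h 0 k / h 0 j = h j k / h j j := by
    rcases hh with rfl | rfl
    · exact ⟨1, 2, by decide, by decide, by decide, by simp [carrierOne]⟩
    -- In the second carrier the order must change: row 1 has direct gain `-1` and is not aligned
    -- with row 0, whereas row 2 is.
    · exact ⟨2, 1, by decide, by decide, by decide, by simp [carrierTwo]⟩
  obtain ⟨b, hE⟩ := exists_emulates_row hne h0j hjk h0k hal zero_le_one le_rfl (hle _ _ _ _)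
    (hle _ _ _ _)
  exact ⟨hE.icCapacityRegion_subset P,
    sumCapacity_le fun R hR => sum_le_half_log hE (hsq 0) hP hR⟩

end GaussianNetwork

end

open GaussianNetwork in
theorem mainTheorem3 :
    -- Outer bound by the two-antenna multiple access channel of the enhanced receiver `i`.
    (∀ (h : Matrix (Fin 3) (Fin 3) ℝ), (∀ i j, h i j ≠ 0) →
      ∀ i j k : Fin 3, i ≠ j → j ≠ k → i ≠ k →
      ∀ (a : Fin 3 → ℝ) (α β : ℝ), GaussianNetwork.Aligned h a α β i j k →
      ∀ K : Matrix (Fin 2) (Fin 2) ℝ, K.PosSemidef → K 0 0 ≤ 1 →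
        GaussianNetwork.combVar K α β ≤ (GaussianNetwork.combGain h a α β i j / h j j) ^ 2 →
        K 0 0 ≤ (h i k / h k k) ^ 2 →
      ∀ P : ℝ, 0 ≤ P → GaussianNetwork.icCapacityRegion h P ⊆
        GaussianNetwork.macCapacityRegion (GaussianNetwork.enhancedGains h a i) K P) ∧
    -- Suitable combining coefficients exist as soon as `S` gives a new combination of `X_j, X_k`.
    (∀ (h : Matrix (Fin 3) (Fin 3) ℝ), (∀ i j, h i j ≠ 0) →
      ∀ i j k : Fin 3, i ≠ j → j ≠ k → i ≠ k →
      ∀ a : Fin 3 → ℝ, h i j * a k ≠ h i k * a j →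
      ∃ α β : ℝ, GaussianNetwork.Aligned h a α β i j k) ∧
    -- Reducing the noise of `Yᵢ` sufficiently always works, whatever its correlation with `Z̃`.
    (∀ (h : Matrix (Fin 3) (Fin 3) ℝ), (∀ i j, h i j ≠ 0) →
      ∀ i j k : Fin 3, i ≠ j → j ≠ k → i ≠ k →
      ∀ (a : Fin 3 → ℝ) (α β : ℝ), GaussianNetwork.Aligned h a α β i j k →
      ∀ s : ℝ, 0 ≤ s → β ^ 2 * s < (GaussianNetwork.combGain h a α β i j / h j j) ^ 2 →
      ∃ t : ℝ, 0 < t ∧ ∀ K : Matrix (Fin 2) (Fin 2) ℝ, K.PosSemidef → K 0 0 ≤ t → K 1 1 ≤ s →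
        ∀ P : ℝ, 0 ≤ P → GaussianNetwork.icCapacityRegion h P ⊆
          GaussianNetwork.macCapacityRegion (GaussianNetwork.enhancedGains h a i) K P) ∧
    -- If the gains are already aligned, no genie is needed.
    (∀ (h : Matrix (Fin 3) (Fin 3) ℝ), (∀ i j, h i j ≠ 0) →
      ∀ i j k : Fin 3, i ≠ j → j ≠ k → i ≠ k → h i k / h i j = h j k / h j j →
      ∀ t : ℝ, 0 ≤ t → t ≤ 1 → t ≤ (h i j / h j j) ^ 2 → t ≤ (h i k / h k k) ^ 2 →
      ∀ P : ℝ, 0 ≤ P → GaussianNetwork.icCapacityRegion h P ⊆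
        GaussianNetwork.macCapacityRegion (Matrix.of ![h i]) !![t] P) ∧
    -- First example, for both carriers.
    (∀ h : Matrix (Fin 3) (Fin 3) ℝ,
      h = GaussianNetwork.carrierOne ∨ h = GaussianNetwork.carrierTwo → ∀ P : ℝ, 0 ≤ P →
      GaussianNetwork.icCapacityRegion h P ⊆
        GaussianNetwork.macCapacityRegion (Matrix.of ![h 0]) !![1] P ∧
      GaussianNetwork.sumCapacity (GaussianNetwork.icCapacityRegion h P) ≤
        ((1 / 2 * Real.log (1 + P) : ℝ) : EReal)) ∧
    -- Second example, the symmetric channel with cross gain `c > 1`.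
    (∀ c : ℝ, 1 < c → ∀ P : ℝ, 0 ≤ P →
      (∀ (a₁ : ℝ) (K : Matrix (Fin 2) (Fin 2) ℝ), K.PosSemidef → K 0 0 = 1 →
        GaussianNetwork.combVar K 1 1 ≤ 1 →
        GaussianNetwork.icCapacityRegion (GaussianNetwork.symmetricGains c) P ⊆
          GaussianNetwork.macCapacityRegion (GaussianNetwork.symmetricMacGains c a₁) K P) ∧
      ∃ m : ℝ, IsLeast (GaussianNetwork.symmetricBounds c P) m ∧
        GaussianNetwork.sumCapacity
            (GaussianNetwork.icCapacityRegion (GaussianNetwork.symmetricGains c) P) ≤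
          ((1 / 2 * m : ℝ) : EReal)) := by
  refine ⟨?_, ?_, ?_, ?_, ?_, ?_⟩
  · intro h hh i j k hij hjk hik a α β hal K hK h1 h2 h3 P _
    obtain ⟨b, hE⟩ := exists_emulates_enhancedGains hh hij hjk hik hal hK h1 h2 h3
    exact hE.icCapacityRegion_subset P
  · intro h hh i j k _ _ _ a ha
    exact exists_aligned hh ha
  · intro h hh i j k hij hjk hik a α β hal s _ hlt
    have hB : 0 < (h i k / h k k) ^ 2 := by
      have := hh i k
      have := hh k k
      positivity
    obtain ⟨t, ht, ht1, htB, hA⟩ := exists_noise_level α β s _ _ hlt hB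
    refine ⟨t, ht, fun K hK h00 h11 P _ => ?_⟩
    obtain ⟨b, hE⟩ := exists_emulates_enhancedGains hh hij hjk hik hal hK (h00.trans ht1)
      ((combVar_le hK h00 h11 α β).trans hA) (h00.trans htB)
    exact hE.icCapacityRegion_subset P
  · intro h hh i j k hij hjk hik hal t ht0 h1 h2 h3 P _
    obtain ⟨b, hE⟩ := exists_emulates_row hh hij hjk hik hal ht0 h1 h2 h3
    exact hE.icCapacityRegion_subset P
  · intro h hh P hP
    exact carrier_bounds hh hP
  · intro c hc P hP
    refine ⟨fun a₁ K hK h00 h11 => ?_, ?_⟩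
    · exact (emulates_symmetric hc a₁ hK h00 h11 (Equiv.refl _)).icCapacityRegion_subset P
    · obtain ⟨m, hm⟩ := exists_isLeast_symmetricBounds hc hP
      refine ⟨m, hm, ?_⟩
      obtain ⟨a₁, K, hK, h00, h11, rfl⟩ := hm.1
      exact sumCapacity_le fun R hR => sum_le_half_logDetMac hc a₁ hK h00 h11 hP hR
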